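/- Let $(E,\mathcal E,m)$ be a $\sigma$-finite measure space and $L^1=L^1(E,\mathcal E,m)$ (real-valued). A substochastic semigroup is a strongly continuous semigroup of positive contractions on $L^1$. Let $(A,\mathcal D(A))$ and $(B,\mathcal D(B))$ be linear operators in $L^1$ such that (G1) $(A,\mathcal D(A))$ is the generator of a substochastic semigroup on $L^1$; (G2) $\mathcal D(B)\supseteq\mathcal D(A)$ and $Bu\ge 0$ for all $u\in\mathcal D(A)$ with $u\ge 0$; (G3) $\int_E (Au+Bu)\,dm=0$ for all $u\in\mathcal D(A)$ with $u\ge 0$. Let $\{P(t)\}_{t\ge 0}$ be the minimal Kato–Voigt semigroup, i.e. the smallest substochastic semigroup whose generator is an extension of $(A+B,\mathcal D(A))$ (smallest: $P(t)u\le Q(t)u$ for all $t\ge0$, $0\le u\in L^1$ and every substochastic semigroup $\{Q(t)\}_{t\ge 0}$ whose generator extends $(A+B,\mathcal D(A))$). For $\lambda>0$ let $R(\lambda,A)=(\lambda-A)^{-1}$, let $(BR(\lambda,A))^*:L^\infty\to L^\infty$ be the adjoint of $BR(\lambda,A)$, and let $$f_\lambda(x)=\lim_{n\to\infty}(BR(\lambda,A))^{*n}1(x)\quad\text{for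 } m\text{-a.e. } x\in E .$$ Each $f_\lambda$ is determined up to an $m$-null set; there are representatives $f_\lambda$, $\lambda>0$, such that for $m$-a.e. $x$ the function $\lambda\mapsto f_\lambda(x)$ is non-increasing on $(0,\infty)$. For any such choice of representatives, $\{P(t)\}_{t\ge 0}$ is strongly stable, i.e. $\lim_{t\to\infty}\|P(t)u\|=0$ for all $u\in L^1$, if and only if $$m\Bigl\{x\in E:\ \liminf_{\lambda\downarrow 0} f_\lambda(x)<1\Bigr\}=0 .$$ -/

import Mathlib

open MeasureTheory Filter Topology Set
open scoped NNReal ENNReal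

/-- A strongly continuous semigroup `{S(t)}_{t ≥ 0}` of bounded linear operators on a real
normed space `X`. -/
structure C0Semigroup (X : Type*) [NormedAddCommGroup X] [NormedSpace ℝ X] where
  toFun : ℝ≥0 → X →L[ℝ] X
  map_zero' : toFun 0 = ContinuousLinearMap.id ℝ X
  map_add' : ∀ s t : ℝ≥0, toFun (s + t) = (toFun s).comp (toFun t)
  continuous' : ∀ u : X, Continuous fun t : ℝ≥0 => toFun t u

namespace C0Semigroup

variable {X : Type*} [NormedAddCommGroup X] [NormedSpace ℝ X]

instance : CoeFun (C0Semigroup X) (fun _ => ℝ≥0 → X →L[ℝ] X) := ⟨toFun⟩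

/-- `v = lim_{t ↓ 0} (S(t) u - u) / t` in norm. -/
def HasGeneratorAt (S : C0Semigroup X) (u v : X) : Prop :=
  Tendsto (fun t : ℝ≥0 => (t : ℝ)⁻¹ • (S t u - u)) (𝓝[>] 0) (𝓝 v)

theorem HasGeneratorAt.unique {S : C0Semigroup X} {u v w : X}
    (hv : S.HasGeneratorAt u v) (hw : S.HasGeneratorAt u w) : v = w :=
  tendsto_nhds_unique hv hw

theorem HasGeneratorAt.add {S : C0Semigroup X} {u u' v v' : X}
    (h : S.HasGeneratorAt u v) (h' : S.HasGeneratorAt u' v') :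
    S.HasGeneratorAt (u + u') (v + v') := by
  refine (Tendsto.add h h').congr fun t => ?_
  rw [← smul_add, map_add]
  congr 1
  abel

theorem HasGeneratorAt.smul {S : C0Semigroup X} {u v : X} (c : ℝ)
    (h : S.HasGeneratorAt u v) : S.HasGeneratorAt (c • u) (c • v) := by
  refine (Tendsto.const_smul h c).congr fun t => ?_
  rw [map_smul, ← smul_sub, smul_comm]

/-- The infinitesimal generator of a strongly continuous semigroup, with its maximal domain
(all `u` for which the limit of the difference quotients exists). -/
noncomputable def generator (S : C0Semigroup X) : X →ₗ.[ℝ] X where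
  domain :=
    { carrier := {u | ∃ v, S.HasGeneratorAt u v}
      add_mem' := fun ⟨v, hv⟩ ⟨w, hw⟩ => ⟨v + w, hv.add hw⟩
      zero_mem' := ⟨0, by simp [HasGeneratorAt]⟩
      smul_mem' := fun c _ ⟨v, hv⟩ => ⟨c • v, hv.smul c⟩ }
  toFun :=
    { toFun := fun u => u.2.choose
      map_add' := fun u w =>
        (u + w).2.choose_spec.unique (u.2.choose_spec.add w.2.choose_spec)
      map_smul' := fun c u =>
        (c • u).2.choose_spec.unique (u.2.choose_spec.smul c) }

/-- Strong stability: `S(t) u → 0` in norm as `t → ∞`, for all `u`. -/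
def StronglyStable (S : C0Semigroup X) : Prop :=
  ∀ u : X, Tendsto (fun t : ℝ≥0 => ‖S t u‖) atTop (𝓝 0)

end C0Semigroup

/-- `R` is the bounded two-sided inverse of `lam - A : 𝒟(A) → X`. -/
def IsResolventAt {X : Type*} [NormedAddCommGroup X] [NormedSpace ℝ X]
    (A : X →ₗ.[ℝ] X) (lam : ℝ) (R : X →L[ℝ] X) : Prop :=
  (∀ v : X, ∃ h : R v ∈ A.domain, lam • R v - A ⟨R v, h⟩ = v) ∧
    ∀ u : A.domain, R (lam • (u : X) - A u) = u

open Classical in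
/-- The resolvent `R(lam, A) = (lam - A)⁻¹` (with value `0` if `lam` is not in the resolvent
set of `A`). -/
noncomputable def resolventOp {X : Type*} [NormedAddCommGroup X] [NormedSpace ℝ X]
    (A : X →ₗ.[ℝ] X) (lam : ℝ) : X →L[ℝ] X :=
  if h : ∃ R : X →L[ℝ] X, IsResolventAt A lam R then h.choose else 0

open Classical in
/-- The everywhere defined linear operator `B R(lam, A)`. It is the composition of `B` with
`R(lam, A)` as soon as `R(lam, A)` maps into `𝒟(B)` (otherwise the value is `0`). -/
noncomputable def opBR {X : Type*} [NormedAddCommGroup X] [NormedSpace ℝ X]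
    (A B : X →ₗ.[ℝ] X) (lam : ℝ) : X →ₗ[ℝ] X :=
  if h : ∀ v : X, (resolventOp A lam : X →ₗ[ℝ] X) v ∈ B.domain then
    B.toFun ∘ₗ (resolventOp A lam : X →ₗ[ℝ] X).codRestrict B.domain h
  else 0

section L1

variable {E : Type*} [MeasurableSpace E] {m : Measure E}

/-- A substochastic semigroup: a strongly continuous semigroup of positive contractions
on `L¹(m)`. -/
def C0Semigroup.IsSubstochastic (S : C0Semigroup (Lp ℝ 1 m)) : Prop :=
  (∀ t : ℝ≥0, ∀ u : Lp ℝ 1 m, 0 ≤ u → 0 ≤ S t u) ∧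
    ∀ t : ℝ≥0, ∀ u : Lp ℝ 1 m, ‖S t u‖ ≤ ‖u‖

/-- `{P(t)}` is the minimal Kato–Voigt semigroup of the pair `(A, B)`: the smallest
substochastic semigroup whose generator is an extension of `A + B` (which has domain
`𝒟(A) ∩ 𝒟(B)`). -/
def IsMinimalKatoVoigt (A B : Lp ℝ 1 m →ₗ.[ℝ] Lp ℝ 1 m) (P : C0Semigroup (Lp ℝ 1 m)) : Prop :=
  (P.IsSubstochastic ∧ A + B ≤ P.generator) ∧
    ∀ Q : C0Semigroup (Lp ℝ 1 m), Q.IsSubstochastic → A + B ≤ Q.generator →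
      ∀ t : ℝ≥0, ∀ u : Lp ℝ 1 m, 0 ≤ u → P t u ≤ Q t u

/-- `T'` is the adjoint of `T` under the duality `⟨g, u⟩ = ∫ g u dm` of `L^∞(m)` and
`L¹(m)`. -/
def IsLinftyAdjoint (T : Lp ℝ 1 m →ₗ[ℝ] Lp ℝ 1 m) (T' : Lp ℝ ∞ m →ₗ[ℝ] Lp ℝ ∞ m) : Prop :=
  ∀ (g : Lp ℝ ∞ m) (u : Lp ℝ 1 m), ∫ x, T' g x * u x ∂m = ∫ x, g x * T u x ∂m

open Classical in
/-- The adjoint `T* : L^∞(m) → L^∞(m)` of an operator `T` on `L¹(m)`. For σ-finite `m` it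
exists for all bounded `T` and is unique; the value is `0` if there is no adjoint. -/
noncomputable def linftyAdjoint (T : Lp ℝ 1 m →ₗ[ℝ] Lp ℝ 1 m) : Lp ℝ ∞ m →ₗ[ℝ] Lp ℝ ∞ m :=
  if h : ∃ T' : Lp ℝ ∞ m →ₗ[ℝ] Lp ℝ ∞ m, IsLinftyAdjoint T T' then h.choose else 0

/-- The constant function `1` as an element of `L^∞(m)`. -/
noncomputable def linftyOne (m : Measure E) : Lp ℝ ∞ m :=
  (memLp_top_const (1 : ℝ)).toLp (fun _ : E => (1 : ℝ))

/-- `f lam` is, for each `lam > 0`, a representative of the a.e. limit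
`f_lam = lim_n (B R(lam, A))^{*n} 1`. -/
def IsLimitFunction (A B : Lp ℝ 1 m →ₗ.[ℝ] Lp ℝ 1 m) (f : ℝ → E → ℝ) : Prop :=
  ∀ lam : ℝ, 0 < lam → ∀ᵐ x ∂m,
    Tendsto (fun n : ℕ => ((linftyAdjoint (opBR A B lam)) ^ n) (linftyOne m) x) atTop
      (𝓝 (f lam x))

/-- Each `f_lam` is determined only up to a null set depending on `lam`, so that a pointwise
lower limit over the continuous parameter `lam ↓ 0` has a meaning only for coherent
representatives. The functions `f_lam` decrease a.e. in `lam`; a coherent choice of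
representatives is one for which this holds for all `lam` simultaneously, for a.e. `x`. -/
def IsCoherentLimitFunction (A B : Lp ℝ 1 m →ₗ.[ℝ] Lp ℝ 1 m) (f : ℝ → E → ℝ) : Prop :=
  IsLimitFunction A B f ∧ ∀ᵐ x ∂m, AntitoneOn (fun lam : ℝ => f lam x) (Ioi 0)

end L1

/-! Write `R = R(λ, A)` and `K = B R`. Since `A R v = λ R v - v`, condition (G3) reads `λ ∫ R v = ∫
v - ∫ K v`; summing over the iterates telescopes to `λ ∑_{n<N} ∫ R Kⁿ v = ∫ v - ∫ K^N v`, and `∫ K^N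
v = ∫ (K*)^N 1 · v`. The resolvent of the minimal semigroup is `∑ R Kⁿ`, so letting `N → ∞` gives,
for every `u`, `∫ f_λ u = ∫ u - λ ∫₀^∞ e^{-λt} (∫ P(t) u dm) dt` (`integral_limitFunction_mul`).

For `u ≥ 0` the mass `∫ P(t) u = ‖P(t) u‖` is non-increasing in `t`. Its Abel mean is therefore
monotone in `λ`, which makes `f_λ` a.e. decreasing in `λ`, and tends to the limit of the mass as `λ
↓ 0`. Hence the lower limit `f₀` satisfies `∫ f₀ u = ∫ u - lim ‖P(t) u‖` (`integral_liminf_mul`). As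
`0 ≤ f₀ ≤ 1` a.e., all these limits vanish exactly when `f₀ = 1` a.e.; one strictly positive
integrable `u` suffices to see the forward direction.

The resolvent formula (`hasSum_laplace`) rests on Kato's theorem: `∑ R Kⁿ` is a contraction
resolvent, and Hille–Yosida turns it into a substochastic semigroup `Q` whose generator extends `A +
B`. Minimality gives `P ≤ Q`, while the resolvent of any substochastic extension dominates the
partial sums of the series; so the two resolvents agree. -/

/-! ### Laplace transform of a contraction semigroup as the resolvent of its generator -/

theorem integral_exp_neg_mul_Ioi_zero {lam : ℝ} (h : 0 < lam) :
    ∫ t in Ioi (0 : ℝ), Real.exp (-(lam * t)) = lam⁻¹ := by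
  have := integral_exp_mul_Ioi (neg_lt_zero.2 h) 0
  simp only [neg_mul, mul_zero, Real.exp_zero] at this
  rw [this, neg_div_neg_eq, one_div]

theorem integrableOn_exp_neg_mul_Ioi_zero {lam : ℝ} (h : 0 < lam) :
    IntegrableOn (fun t : ℝ => Real.exp (-(lam * t))) (Ioi 0) := by
  simpa only [neg_mul] using exp_neg_integrableOn_Ioi 0 h

theorem setIntegral_Ioi_comp_add {X : Type*} [NormedAddCommGroup X] [NormedSpace ℝ X]
    (g : ℝ → X) (h : ℝ) : ∫ t in Ioi (0 : ℝ), g (t + h) = ∫ t in Ioi h, g t := by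
  have := (measurePreserving_add_right (volume : Measure ℝ) h).setIntegral_preimage_emb
    (measurableEmbedding_addRight h) g (Ioi h)
  simpa using this

namespace C0Semigroup

variable {X : Type*} [NormedAddCommGroup X] [NormedSpace ℝ X]

/-- All operators of the semigroup are contractions. -/
def IsContraction (S : C0Semigroup X) : Prop := ∀ t : ℝ≥0, ∀ u : X, ‖S t u‖ ≤ ‖u‖

/-- The integrand of the Laplace transform of an orbit. -/
noncomputable def laplaceIntegrand (S : C0Semigroup X) (lam : ℝ) (u : X) (t : ℝ) : X :=
  Real.exp (-(lam * t)) • S t.toNNReal u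

theorem continuous_laplaceIntegrand (S : C0Semigroup X) (lam : ℝ) (u : X) :
    Continuous (S.laplaceIntegrand lam u) := by
  have h1 : Continuous fun t : ℝ => S t.toNNReal u :=
    (S.continuous' u).comp continuous_real_toNNReal
  unfold laplaceIntegrand
  fun_prop

theorem IsContraction.norm_laplaceIntegrand_le {S : C0Semigroup X} (hS : S.IsContraction)
    (lam : ℝ) (u : X) (t : ℝ) :
    ‖S.laplaceIntegrand lam u t‖ ≤ Real.exp (-(lam * t)) * ‖u‖ := by
  rw [laplaceIntegrand, norm_smul, Real.norm_eq_abs, Real.abs_exp]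
  gcongr
  exact hS _ _

theorem IsContraction.integrableOn_laplaceIntegrand {S : C0Semigroup X} (hS : S.IsContraction)
    {lam : ℝ} (h : 0 < lam) (u : X) :
    IntegrableOn (S.laplaceIntegrand lam u) (Ioi 0) :=
  ((integrableOn_exp_neg_mul_Ioi_zero h).mul_const ‖u‖).mono'
    (S.continuous_laplaceIntegrand lam u).aestronglyMeasurable
    (Eventually.of_forall (hS.norm_laplaceIntegrand_le lam u))

/-- The Laplace transform of a contraction semigroup. -/
noncomputable def laplace (S : C0Semigroup X) (hS : S.IsContraction) {lam : ℝ} (h : 0 < lam) :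
    X →L[ℝ] X :=
  LinearMap.mkContinuous
    { toFun := fun u => ∫ t in Ioi (0 : ℝ), S.laplaceIntegrand lam u t
      map_add' := fun u v => by
        rw [← integral_add (hS.integrableOn_laplaceIntegrand h u)
          (hS.integrableOn_laplaceIntegrand h v)]
        simp only [laplaceIntegrand, map_add, smul_add]
      map_smul' := fun c u => by
        rw [RingHom.id_apply, ← integral_smul]
        simp only [laplaceIntegrand, map_smul, smul_comm c] }
    lam⁻¹ (fun u => by
      rw [← integral_exp_neg_mul_Ioi_zero h, ← integral_mul_const]
      exact norm_integral_le_of_norm_le ((integrableOn_exp_neg_mul_Ioi_zero h).mul_const ‖u‖)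
        (Eventually.of_forall (hS.norm_laplaceIntegrand_le lam u)))

theorem laplace_apply (S : C0Semigroup X) (hS : S.IsContraction) {lam : ℝ} (h : 0 < lam)
    (u : X) : S.laplace hS h u = ∫ t in Ioi (0 : ℝ), S.laplaceIntegrand lam u t := rfl

theorem hasGeneratorAt_of_hasDerivAt (S : C0Semigroup X) {u v : X} {F : ℝ → X}
    (hF : ∀ t : ℝ≥0, S t u = F t) (hd : HasDerivAt F v 0) : S.HasGeneratorAt u v := by
  have h0 : u = F 0 := by
    have := hF 0
    rwa [S.map_zero', NNReal.coe_zero] at this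
  have h1 := hasDerivAt_iff_tendsto_slope.1 hd
  have h2 : Tendsto (fun t : ℝ≥0 => (t : ℝ)) (𝓝[>] 0) (𝓝[≠] 0) := by
    refine tendsto_nhdsWithin_iff.2 ⟨?_, ?_⟩
    · exact (NNReal.continuous_coe.tendsto' 0 0 rfl).mono_left nhdsWithin_le_nhds
    · filter_upwards [self_mem_nhdsWithin] with t ht
      exact NNReal.coe_ne_zero.2 (ne_of_gt ht)
  refine (h1.comp h2).congr fun t => ?_
  simp only [Function.comp, slope_def_module, sub_zero, hF]
  rw [h0]

theorem generator_apply (S : C0Semigroup X) {u v : X} (h : S.HasGeneratorAt u v) :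
    ∃ hu : u ∈ S.generator.domain, S.generator ⟨u, hu⟩ = v := by
  have hu : u ∈ S.generator.domain := ⟨v, h⟩
  exact ⟨hu, HasGeneratorAt.unique (S := S) (Exists.choose_spec hu) h⟩

theorem hasGeneratorAt_generator (S : C0Semigroup X) (u : S.generator.domain) :
    S.HasGeneratorAt u (S.generator u) := Exists.choose_spec u.2

variable [CompleteSpace X]

theorem map_laplace (S : C0Semigroup X) (hS : S.IsContraction) {lam : ℝ} (h : 0 < lam)
    (t : ℝ≥0) (u : X) : S t (S.laplace hS h u) = S.laplace hS h (S t u) := by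
  rw [laplace_apply, laplace_apply,
    ← ContinuousLinearMap.integral_comp_comm _ (hS.integrableOn_laplaceIntegrand h u)]
  congr 1
  ext s
  have : S t (S s.toNNReal u) = S s.toNNReal (S t u) := by
    rw [← ContinuousLinearMap.comp_apply, ← ContinuousLinearMap.comp_apply, ← S.map_add',
      ← S.map_add', add_comm]
  simp only [laplaceIntegrand, map_smul, this]

/-- Translating the Laplace integral by `t` removes `[0, t]` and costs a factor `e^{lam t}`. The
right side is differentiable in real `t`, so its derivative at `0` yields the generator. -/
theorem map_laplace_eq (S : C0Semigroup X) (hS : S.IsContraction) {lam : ℝ} (h : 0 < lam)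
    (t : ℝ≥0) (u : X) : S t (S.laplace hS h u) =
      Real.exp (lam * t) • (S.laplace hS h u - ∫ s in (0 : ℝ)..t, S.laplaceIntegrand lam u s) := by
  have hint := hS.integrableOn_laplaceIntegrand h u
  rw [← intervalIntegral.integral_Ioi_sub_Ioi hint (NNReal.coe_nonneg t), laplace_apply,
    sub_sub_cancel, ← ContinuousLinearMap.integral_comp_comm _ hint,
    ← setIntegral_Ioi_comp_add (S.laplaceIntegrand lam u) t, ← integral_smul]
  refine setIntegral_congr_fun measurableSet_Ioi fun s hs => ?_
  have hs0 : (0 : ℝ) ≤ s := (mem_Ioi.1 hs).le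
  have : S t (S s.toNNReal u) = S (s + t : ℝ).toNNReal u := by
    rw [← ContinuousLinearMap.comp_apply, ← S.map_add', Real.toNNReal_add hs0 (NNReal.coe_nonneg t),
      Real.toNNReal_coe, add_comm]
  simp only [laplaceIntegrand, map_smul, this, smul_smul, ← Real.exp_add]
  congr 2
  ring

theorem hasGeneratorAt_laplace (S : C0Semigroup X) (hS : S.IsContraction) {lam : ℝ}
    (h : 0 < lam) (u : X) :
    S.HasGeneratorAt (S.laplace hS h u) (lam • S.laplace hS h u - u) := by
  refine S.hasGeneratorAt_of_hasDerivAt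
    (F := fun t : ℝ => Real.exp (lam * t) •
      (S.laplace hS h u - ∫ s in (0 : ℝ)..t, S.laplaceIntegrand lam u s))
    (fun t => S.map_laplace_eq hS h t u) ?_
  have h1 : HasDerivAt (fun t : ℝ => Real.exp (lam * t)) lam 0 := by
    have := ((hasDerivAt_id (0 : ℝ)).const_mul lam).exp
    simpa using this
  have h2 := ((S.continuous_laplaceIntegrand lam u).integral_hasStrictDerivAt 0 0).hasDerivAt
  have h3 := h1.smul (h2.const_sub (S.laplace hS h u))
  have h0 : Real.exp (lam * 0) • -S.laplaceIntegrand lam u 0 +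
      lam • (S.laplace hS h u - ∫ s in (0 : ℝ)..0, S.laplaceIntegrand lam u s) =
        lam • S.laplace hS h u - u := by
    simp [laplaceIntegrand, S.map_zero']
    abel
  rw [h0] at h3
  exact h3

/-- The Laplace transform is continuous and commutes with the semigroup, so it carries the
difference quotients of `u` to those of its image, where the generator is already known. -/
theorem laplace_of_hasGeneratorAt (S : C0Semigroup X) (hS : S.IsContraction) {lam : ℝ}
    (h : 0 < lam) {u v : X} (huv : S.HasGeneratorAt u v) :
    S.laplace hS h (lam • u - v) = u := by
  have h1 : S.HasGeneratorAt (S.laplace hS h u) (S.laplace hS h v) := by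
    refine (((S.laplace hS h).continuous.tendsto v).comp huv).congr fun t => ?_
    simp only [Function.comp, map_smul, map_sub, S.map_laplace]
  rw [map_sub, map_smul, h1.unique (S.hasGeneratorAt_laplace hS h u), sub_sub_cancel]

theorem isResolventAt_laplace (S : C0Semigroup X) (hS : S.IsContraction) {lam : ℝ}
    (h : 0 < lam) : IsResolventAt S.generator lam (S.laplace hS h) := by
  refine ⟨fun v => ?_, fun u => S.laplace_of_hasGeneratorAt hS h (S.hasGeneratorAt_generator u)⟩
  obtain ⟨hu, he⟩ := S.generator_apply (S.hasGeneratorAt_laplace hS h v)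
  exact ⟨hu, by rw [he, sub_sub_cancel]⟩

theorem resolventOp_generator (S : C0Semigroup X) (hS : S.IsContraction) {lam : ℝ}
    (h : 0 < lam) : resolventOp S.generator lam = S.laplace hS h := by
  have hex : ∃ R : X →L[ℝ] X, IsResolventAt S.generator lam R := ⟨_, S.isResolventAt_laplace hS h⟩
  rw [resolventOp, dif_pos hex]
  ext v
  obtain ⟨hm, he⟩ := (S.isResolventAt_laplace hS h).1 v
  have := hex.choose_spec.2 ⟨_, hm⟩
  rwa [he] at this

/-- Rescaling time turns the left side into the average of `S(s / (n + 1)) u` against the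
probability density `e^{-s}`; strong continuity at `0` and dominated convergence finish. -/
theorem tendsto_smul_laplace (S : C0Semigroup X) (hS : S.IsContraction) (u : X) :
    Tendsto (fun n : ℕ => ((n : ℝ) + 1) • S.laplace hS (Nat.cast_add_one_pos n) u) atTop (𝓝 u) := by
  have key : ∀ n : ℕ, ((n : ℝ) + 1) • S.laplace hS (Nat.cast_add_one_pos n) u =
      ∫ s in Ioi (0 : ℝ), Real.exp (-s) • S (((n : ℝ) + 1)⁻¹ * s).toNNReal u := by
    intro n
    have hn : (0 : ℝ) < n + 1 := Nat.cast_add_one_pos n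
    have := integral_comp_mul_left_Ioi (S.laplaceIntegrand ((n : ℝ) + 1) u) 0 (inv_pos.2 hn)
    rw [mul_zero, inv_inv] at this
    rw [laplace_apply, ← this]
    simp only [laplaceIntegrand, mul_inv_cancel_left₀ hn.ne']
  simp only [key]
  have hlim : u = ∫ s in Ioi (0 : ℝ), Real.exp (-s) • u := by
    have := integral_exp_neg_mul_Ioi_zero one_pos
    simp only [one_mul, inv_one] at this
    rw [integral_smul_const, this, one_smul]
  conv => arg 3; rw [hlim]
  have hb := (integrableOn_exp_neg_mul_Ioi_zero one_pos).mul_const ‖u‖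
  simp only [one_mul] at hb
  refine tendsto_integral_of_dominated_convergence _ (fun n => ?_) hb
    (fun n => Eventually.of_forall fun s => ?_) (Eventually.of_forall fun s => ?_)
  · have h1 : Continuous fun s : ℝ => S (((n : ℝ) + 1)⁻¹ * s).toNNReal u :=
      (S.continuous' u).comp (continuous_real_toNNReal.comp (by fun_prop))
    exact (by fun_prop : Continuous fun s : ℝ =>
      Real.exp (-s) • S (((n : ℝ) + 1)⁻¹ * s).toNNReal u).aestronglyMeasurable
  · rw [norm_smul, Real.norm_eq_abs, Real.abs_exp]
    gcongr
    exact hS _ _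
  · have h0 : Tendsto (fun n : ℕ => (((n : ℝ) + 1)⁻¹ * s).toNNReal) atTop (𝓝 0) := by
      have : Tendsto (fun n : ℕ => ((n : ℝ) + 1)⁻¹ * s) atTop (𝓝 (0 * s)) := by
        refine Tendsto.mul_const _ ?_
        simpa only [one_div] using tendsto_one_div_add_atTop_nhds_zero_nat (𝕜 := ℝ)
      rw [zero_mul] at this
      simpa [Function.comp_def] using (continuous_real_toNNReal.tendsto _).comp this
    have h1 := ((S.continuous' u).tendsto 0).comp h0
    have h2 := h1.const_smul (Real.exp (-s))
    simpa [S.map_zero'] using h2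

theorem dense_generator_domain (S : C0Semigroup X) (hS : S.IsContraction) :
    Dense (S.generator.domain : Set X) := fun u =>
  mem_closure_of_tendsto (S.tendsto_smul_laplace hS u) (Eventually.of_forall fun _ =>
    S.generator.domain.smul_mem _ (S.generator_apply (S.hasGeneratorAt_laplace hS _ u)).1)

end C0Semigroup

/-! ### Exponentials of bounded operators -/

section ExpOperator

variable {X : Type*} [NormedAddCommGroup X] [NormedSpace ℝ X] [CompleteSpace X]

theorem hasSum_exp_apply (B : X →L[ℝ] X) (u : X) :
    HasSum (fun n : ℕ => ((n.factorial : ℝ)⁻¹) • (B ^ n) u) (NormedSpace.exp B u) :=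
  (NormedSpace.exp_series_hasSum_exp' (𝕂 := ℝ) B).mapL (ContinuousLinearMap.apply ℝ X u)

theorem exp_smul_sub_smul_one (B : X →L[ℝ] X) (c t : ℝ) :
    NormedSpace.exp (t • (B - c • (1 : X →L[ℝ] X))) =
      Real.exp (-(c * t)) • NormedSpace.exp (t • B) := by
  let _ : NormedAlgebra ℚ (X →L[ℝ] X) := NormedAlgebra.restrictScalars ℚ ℝ _
  have h1 : t • (B - c • (1 : X →L[ℝ] X)) = algebraMap ℝ (X →L[ℝ] X) (-(c * t)) + t • B := by
    rw [Algebra.algebraMap_eq_smul_one, smul_sub, smul_smul, neg_smul, mul_comm c t]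
    abel
  rw [h1, NormedSpace.exp_add_of_commute (Algebra.commutes _ _),
    ← NormedSpace.algebraMap_exp_comm, ← Real.exp_eq_exp_ℝ, Algebra.algebraMap_eq_smul_one,
    smul_mul_assoc, one_mul]

theorem norm_exp_smul_apply_le {B : X →L[ℝ] X} {c t : ℝ} (hB : ∀ u, ‖B u‖ ≤ c * ‖u‖)
    (ht : 0 ≤ t) (hc : 0 ≤ c) (u : X) :
    ‖NormedSpace.exp (t • B) u‖ ≤ Real.exp (c * t) * ‖u‖ := by
  have h1 := hasSum_exp_apply (t • B) u
  have hpow : ∀ n : ℕ, ‖(B ^ n) u‖ ≤ c ^ n * ‖u‖ := by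
    intro n
    induction n with
    | zero => simp
    | succ k ih =>
      rw [pow_succ', mul_apply_eq_comp, pow_succ', mul_assoc]
      exact (hB _).trans (mul_le_mul_of_nonneg_left ih hc)
  have h2 : HasSum (fun n : ℕ => ((n.factorial : ℝ)⁻¹ * (c * t) ^ n) * ‖u‖)
      (Real.exp (c * t) * ‖u‖) := by
    have := NormedSpace.exp_series_hasSum_exp' (𝕂 := ℝ) (c * t)
    rw [← Real.exp_eq_exp_ℝ] at this
    exact this.mul_right _
  refine h1.norm_le_of_bounded h2 fun n => ?_
  rw [smul_pow, smul_apply, norm_smul, norm_smul, norm_inv, norm_pow,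
    Real.norm_natCast, Real.norm_of_nonneg ht, mul_pow, mul_assoc, mul_comm (c ^ n), mul_assoc]
  gcongr
  exact hpow n

/-- Interpolate along `s ↦ exp(sY) exp((t - s)Z) u`, written as `exp(s(Y - Z)) exp(tZ) u` by
commutativity. Its derivative is a product of two contractions applied to `(Y - Z) u`. -/
theorem norm_exp_sub_exp_apply_le {Y Z : X →L[ℝ] X} (hYZ : Commute Y Z)
    (hY : ∀ t : ℝ, 0 ≤ t → ∀ u, ‖NormedSpace.exp (t • Y) u‖ ≤ ‖u‖)
    (hZ : ∀ t : ℝ, 0 ≤ t → ∀ u, ‖NormedSpace.exp (t • Z) u‖ ≤ ‖u‖) {t : ℝ} (ht : 0 ≤ t) (u : X) :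
    ‖NormedSpace.exp (t • Y) u - NormedSpace.exp (t • Z) u‖ ≤ t * ‖Y u - Z u‖ := by
  let _ : NormedAlgebra ℚ (X →L[ℝ] X) := NormedAlgebra.restrictScalars ℚ ℝ _
  set D := Y - Z with hD
  have hDZ : Commute D Z := (hYZ.sub_left (Commute.refl Z))
  have hsplit : ∀ s : ℝ, NormedSpace.exp (s • D) * NormedSpace.exp (t • Z) =
      NormedSpace.exp (s • Y) * NormedSpace.exp ((t - s) • Z) := by
    intro s
    rw [← NormedSpace.exp_add_of_commute ((hDZ.smul_left s).smul_right t),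
      ← NormedSpace.exp_add_of_commute ((hYZ.smul_left s).smul_right (t - s)), hD]
    congr 1
    module
  have hderiv : ∀ s : ℝ, HasDerivAt
      (fun s : ℝ => NormedSpace.exp (s • D) (NormedSpace.exp (t • Z) u))
      (NormedSpace.exp (s • D) (D (NormedSpace.exp (t • Z) u))) s := fun s =>
    (hasDerivAt_exp_smul_const D s).clm_apply (hasDerivAt_const s _) |>.congr_deriv (by simp)
  have hcomm : D (NormedSpace.exp (t • Z) u) = NormedSpace.exp (t • Z) (D u) := by
    have := (hDZ.smul_right t).exp_right
    exact DFunLike.congr_fun this.eq u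
  have hbound : ∀ s ∈ Ico (0 : ℝ) t,
      ‖NormedSpace.exp (s • D) (D (NormedSpace.exp (t • Z) u))‖ ≤ ‖D u‖ := by
    intro s hs
    rw [hcomm, ← mul_apply_eq_comp, hsplit, mul_apply_eq_comp]
    exact (hY s hs.1 _).trans (hZ _ (sub_nonneg.2 hs.2.le) _)
  have := norm_image_sub_le_of_norm_deriv_le_segment' (fun s _ => (hderiv s).hasDerivWithinAt)
    hbound t (right_mem_Icc.2 ht)
  rw [← mul_apply_eq_comp, hsplit] at this
  simpa [hD, mul_comm] using this

theorem norm_exp_sub_exp_apply_time_le {Y : X →L[ℝ] X}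
    (hY : ∀ t : ℝ, 0 ≤ t → ∀ u, ‖NormedSpace.exp (t • Y) u‖ ≤ ‖u‖) {s t : ℝ} (hs : 0 ≤ s)
    (ht : 0 ≤ t) (u : X) :
    ‖NormedSpace.exp (t • Y) u - NormedSpace.exp (s • Y) u‖ ≤ ‖Y u‖ * |t - s| := by
  refine (convex_Ici (0 : ℝ)).norm_image_sub_le_of_norm_hasDerivWithin_le
    (f := fun s : ℝ => NormedSpace.exp (s • Y) u) (f' := fun s => NormedSpace.exp (s • Y) (Y u))
    (fun r _ => ?_) (fun r hr => hY r hr _) hs ht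
  exact ((hasDerivAt_exp_smul_const Y r).clm_apply
    (hasDerivAt_const r u) |>.congr_deriv (by simp)).hasDerivWithinAt

theorem exp_smul_apply_sub_eq_integral (Y : X →L[ℝ] X) (t : ℝ) (u : X) :
    NormedSpace.exp (t • Y) u - u = ∫ s in (0 : ℝ)..t, NormedSpace.exp (s • Y) (Y u) := by
  let _ : NormedAlgebra ℚ (X →L[ℝ] X) := NormedAlgebra.restrictScalars ℚ ℝ _
  have hd : ∀ s : ℝ, HasDerivAt (fun s : ℝ => NormedSpace.exp (s • Y) u)
      (NormedSpace.exp (s • Y) (Y u)) s := fun s =>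
    (hasDerivAt_exp_smul_const Y s).clm_apply (hasDerivAt_const s u) |>.congr_deriv (by simp)
  have hc : Continuous fun s : ℝ => NormedSpace.exp (s • Y) (Y u) :=
    (NormedSpace.exp_continuous.comp (continuous_id.smul continuous_const)).clm_apply
      continuous_const
  rw [intervalIntegral.integral_eq_sub_of_hasDerivAt (fun s _ => hd s) (hc.intervalIntegrable _ _)]
  simp

end ExpOperator

/-! ### Yosida approximation and the Hille–Yosida theorem -/

section HilleYosida

variable {X : Type*} [NormedAddCommGroup X] [NormedSpace ℝ X]

/-- A pseudo-resolvent on `(0, ∞)` with dense range such that the operators `lam • J lam` are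
contractions. -/
structure IsContractionResolvent (J : ℝ → X →L[ℝ] X) : Prop where
  norm_le : ∀ lam : ℝ, 0 < lam → ∀ u, ‖J lam u‖ ≤ lam⁻¹ * ‖u‖
  resolvent_eq : ∀ lam mu : ℝ, 0 < lam → 0 < mu → ∀ u, J mu u = J lam (u + (lam - mu) • J mu u)
  dense_range : Dense (range (J 1))

/-- The Yosida approximations `n² J(n) - n`, `n = 1, 2, …`. -/
noncomputable def yosidaApprox (J : ℝ → X →L[ℝ] X) (n : ℕ) : X →L[ℝ] X :=
  ((n : ℝ) + 1) ^ 2 • J (n + 1) - ((n : ℝ) + 1) • (1 : X →L[ℝ] X)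

theorem yosidaApprox_apply (J : ℝ → X →L[ℝ] X) (n : ℕ) (u : X) :
    yosidaApprox J n u = ((n : ℝ) + 1) ^ 2 • J (n + 1) u - ((n : ℝ) + 1) • u := rfl

namespace IsContractionResolvent

variable {J : ℝ → X →L[ℝ] X} (hJ : IsContractionResolvent J)
include hJ

/-- The resolvent equation and its version with `lam`, `mu` exchanged express the same difference
through both products; divide by `lam - mu`. -/
theorem commute {lam mu : ℝ} (hl : 0 < lam) (hm : 0 < mu) : Commute (J lam) (J mu) := by
  rcases eq_or_ne lam mu with rfl | hne
  · exact Commute.refl _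
  ext u
  simp only [mul_apply_eq_comp]
  have h1 := hJ.resolvent_eq lam mu hl hm u
  have h2 := hJ.resolvent_eq mu lam hm hl u
  rw [map_add, map_smul] at h1 h2
  have h3 : (lam - mu) • J lam (J mu u) = (lam - mu) • J mu (J lam u) := by
    rw [← sub_eq_iff_eq_add'] at h1 h2
    rw [← h1, ← neg_sub mu lam, neg_smul, ← h2, neg_sub]
  exact smul_right_injective X (sub_ne_zero.2 hne) h3

theorem commute_yosidaApprox (n k : ℕ) : Commute (yosidaApprox J n) (yosidaApprox J k) := by
  have h := hJ.commute (Nat.cast_add_one_pos (α := ℝ) n) (Nat.cast_add_one_pos (α := ℝ) k)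
  unfold yosidaApprox
  refine Commute.sub_left (Commute.sub_right ?_ ?_) (Commute.sub_right ?_ ?_)
  · exact (h.smul_left _).smul_right _
  · exact (Commute.one_right _).smul_right _
  · exact (Commute.one_left _).smul_left _
  · exact (Commute.one_left _).smul_left _

/-- On the range of `J 1` the resolvent equation writes the error as `J (n + 1) (J 1 y - y)`, which
is `O(1/n)`. Density and the uniform contraction bound give the rest. -/
theorem tendsto_smul_apply (u : X) :
    Tendsto (fun n : ℕ => ((n : ℝ) + 1) • J (n + 1) u) atTop (𝓝 u) := by
  have hc : ∀ n : ℕ, (0 : ℝ) < (n : ℝ) + 1 := fun n => Nat.cast_add_one_pos n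
  have hnorm : ∀ (n : ℕ) (v : X), ‖((n : ℝ) + 1) • J (n + 1) v‖ ≤ ‖v‖ := by
    intro n v
    rw [norm_smul, Real.norm_of_nonneg (hc n).le]
    calc ((n : ℝ) + 1) * ‖J (n + 1) v‖ ≤ ((n : ℝ) + 1) * (((n : ℝ) + 1)⁻¹ * ‖v‖) := by
          gcongr
          exact hJ.norm_le _ (hc n) v
      _ = ‖v‖ := mul_inv_cancel_left₀ (hc n).ne' _
  have hran : ∀ y : X, Tendsto (fun n : ℕ => ((n : ℝ) + 1) • J (n + 1) (J 1 y)) atTop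
      (𝓝 (J 1 y)) := by
    intro y
    have hinv : Tendsto (fun n : ℕ => ((n : ℝ) + 1)⁻¹ * ‖J 1 y - y‖) atTop (𝓝 0) := by
      rw [← zero_mul ‖J 1 y - y‖]
      refine Tendsto.mul_const _ ?_
      simpa only [one_div] using tendsto_one_div_add_atTop_nhds_zero_nat (𝕜 := ℝ)
    refine tendsto_iff_norm_sub_tendsto_zero.2 (squeeze_zero (fun _ => norm_nonneg _)
      (fun n => ?_) hinv)
    have h1 := hJ.resolvent_eq (n + 1) 1 (hc n) one_pos y
    have h2 : ((n : ℝ) + 1) • J (n + 1) (J 1 y) - J 1 y = J (n + 1) (J 1 y - y) := by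
      conv_lhs => rw [sub_eq_add_neg]; arg 2; rw [h1]
      simp only [map_add, map_smul, map_sub]
      module
    rw [h2]
    exact hJ.norm_le _ (hc n) _
  rw [Metric.tendsto_atTop]
  intro ε hε
  obtain ⟨_, hy, y, rfl⟩ := Metric.dense_iff.1 hJ.dense_range u (ε / 3) (by positivity)
  obtain ⟨N, hN⟩ := Metric.tendsto_atTop.1 (hran y) (ε / 3) (by positivity)
  refine ⟨N, fun n hn => ?_⟩
  have h1 := hnorm n (u - J 1 y)
  rw [map_sub, smul_sub, ← dist_eq_norm, ← dist_eq_norm] at h1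
  have h2 := hN n hn
  rw [Metric.mem_ball] at hy
  rw [dist_comm u] at h1
  calc dist (((n : ℝ) + 1) • J (n + 1) u) u
      ≤ dist (((n : ℝ) + 1) • J (n + 1) u) (((n : ℝ) + 1) • J (n + 1) (J 1 y)) +
        dist (((n : ℝ) + 1) • J (n + 1) (J 1 y)) (J 1 y) + dist (J 1 y) u := dist_triangle4 _ _ _ _
    _ < ε := by linarith

/-- By the resolvent equation the left side equals `(n + 1) • J (n + 1) (mu • J mu u - u)`. -/
theorem tendsto_yosidaApprox {mu : ℝ} (hm : 0 < mu) (u : X) :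
    Tendsto (fun n : ℕ => yosidaApprox J n (J mu u)) atTop (𝓝 (mu • J mu u - u)) := by
  have h := ((hJ.tendsto_smul_apply (J mu u)).const_smul mu).sub (hJ.tendsto_smul_apply u)
  refine h.congr fun n => ?_
  have hc : (0 : ℝ) < (n : ℝ) + 1 := Nat.cast_add_one_pos n
  have h1 := hJ.resolvent_eq (n + 1) mu hc hm u
  rw [yosidaApprox_apply]
  conv_rhs => arg 2; rw [h1]
  simp only [map_add, map_smul]
  module

end IsContractionResolvent

end HilleYosida

namespace IsContractionResolvent

variable {X : Type*} [NormedAddCommGroup X] [NormedSpace ℝ X] [CompleteSpace X]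
  {J : ℝ → X →L[ℝ] X} (hJ : IsContractionResolvent J)
include hJ

theorem norm_exp_yosidaApprox_le (n : ℕ) (t : ℝ) (ht : 0 ≤ t) (u : X) :
    ‖NormedSpace.exp (t • yosidaApprox J n) u‖ ≤ ‖u‖ := by
  have hc : (0 : ℝ) < (n : ℝ) + 1 := Nat.cast_add_one_pos n
  have hB : ∀ v, ‖(((n : ℝ) + 1) ^ 2 • J (n + 1)) v‖ ≤ ((n : ℝ) + 1) * ‖v‖ := by
    intro v
    rw [smul_apply, norm_smul, Real.norm_of_nonneg (by positivity)]
    calc ((n : ℝ) + 1) ^ 2 * ‖J (n + 1) v‖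
        ≤ ((n : ℝ) + 1) ^ 2 * (((n : ℝ) + 1)⁻¹ * ‖v‖) := by
          gcongr
          exact hJ.norm_le _ hc v
      _ = ((n : ℝ) + 1) * ‖v‖ := by field_simp
  rw [yosidaApprox, exp_smul_sub_smul_one, smul_apply, norm_smul, Real.norm_eq_abs, Real.abs_exp]
  calc Real.exp (-(((n : ℝ) + 1) * t)) *
        ‖NormedSpace.exp (t • (((n : ℝ) + 1) ^ 2 • J (n + 1))) u‖
      ≤ Real.exp (-(((n : ℝ) + 1) * t)) * (Real.exp (((n : ℝ) + 1) * t) * ‖u‖) := by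
        gcongr
        exact norm_exp_smul_apply_le hB ht hc.le u
    _ = ‖u‖ := by rw [← mul_assoc, ← Real.exp_add, neg_add_cancel, Real.exp_zero, one_mul]

/-- On the range of `J 1` the exponentials differ by at most `t` times the difference of the Yosida
approximations, which converge there; contractivity extends this to the closure. -/
theorem cauchySeq_exp_yosidaApprox (t : ℝ≥0) (u : X) :
    CauchySeq fun n : ℕ => NormedSpace.exp ((t : ℝ) • yosidaApprox J n) u := by
  rw [Metric.cauchySeq_iff']
  intro ε hε
  obtain ⟨_, hy, y, rfl⟩ := Metric.dense_iff.1 hJ.dense_range u (ε / 3) (by positivity)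
  have hcs := (hJ.tendsto_yosidaApprox one_pos y).cauchySeq
  obtain ⟨N, hN⟩ := Metric.cauchySeq_iff'.1 hcs (ε / (3 * (t + 1))) (by positivity)
  refine ⟨N, fun n hn => ?_⟩
  have h1 : ∀ k, dist (NormedSpace.exp ((t : ℝ) • yosidaApprox J k) u)
      (NormedSpace.exp ((t : ℝ) • yosidaApprox J k) (J 1 y)) ≤ dist u (J 1 y) := by
    intro k
    rw [dist_eq_norm, dist_eq_norm, ← map_sub]
    exact hJ.norm_exp_yosidaApprox_le k t t.2 _
  have h2 : dist (NormedSpace.exp ((t : ℝ) • yosidaApprox J n) (J 1 y))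
      (NormedSpace.exp ((t : ℝ) • yosidaApprox J N) (J 1 y)) ≤ ε / 3 := by
    rw [dist_eq_norm]
    refine (norm_exp_sub_exp_apply_le (hJ.commute_yosidaApprox n N)
      (hJ.norm_exp_yosidaApprox_le n) (hJ.norm_exp_yosidaApprox_le N) t.2 _).trans ?_
    rw [← dist_eq_norm]
    calc (t : ℝ) * dist (yosidaApprox J n (J 1 y)) (yosidaApprox J N (J 1 y))
        ≤ (t + 1) * (ε / (3 * (t + 1))) :=
          mul_le_mul (by linarith) (hN n hn).le dist_nonneg (by positivity)
      _ = ε / 3 := by field_simp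
  have h3 := h1 n
  have h4 := h1 N
  rw [Metric.mem_ball, dist_comm] at hy
  rw [dist_comm] at h4
  linarith [dist_triangle4 (NormedSpace.exp ((t : ℝ) • yosidaApprox J n) u)
    (NormedSpace.exp ((t : ℝ) • yosidaApprox J n) (J 1 y))
    (NormedSpace.exp ((t : ℝ) • yosidaApprox J N) (J 1 y))
    (NormedSpace.exp ((t : ℝ) • yosidaApprox J N) u)]

/-- **Hille–Yosida theorem** for contraction resolvents. -/
theorem exists_semigroup :
    ∃ S : C0Semigroup X, S.IsContraction ∧
      (∀ mu : ℝ, 0 < mu → ∀ u, S.HasGeneratorAt (J mu u) (mu • J mu u - u)) ∧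
      ∀ (t : ℝ≥0) (u : X),
        Tendsto (fun n : ℕ => NormedSpace.exp ((t : ℝ) • yosidaApprox J n) u) atTop (𝓝 (S t u)) := by
  let _ : NormedAlgebra ℚ (X →L[ℝ] X) := NormedAlgebra.restrictScalars ℚ ℝ _
  choose L hL using fun (t : ℝ≥0) (u : X) =>
    cauchySeq_tendsto_of_complete (hJ.cauchySeq_exp_yosidaApprox t u)
  have hLnorm : ∀ t u, ‖L t u‖ ≤ ‖u‖ := fun t u =>
    le_of_tendsto (hL t u).norm
      (Eventually.of_forall fun n => hJ.norm_exp_yosidaApprox_le n t t.2 u)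
  let T : ℝ≥0 → X →L[ℝ] X := fun t => LinearMap.mkContinuous
    { toFun := L t
      map_add' := fun u v => tendsto_nhds_unique (hL t (u + v)) (by
        simpa only [map_add] using (hL t u).add (hL t v))
      map_smul' := fun c u => tendsto_nhds_unique (hL t (c • u)) (by
        simpa only [map_smul, RingHom.id_apply] using (hL t u).const_smul c) } 1
    (fun u => by simpa using hLnorm t u)
  have hT : ∀ t u, T t u = L t u := fun _ _ => rfl
  have hLlip : ∀ (y : X) (s t : ℝ≥0),
      dist (L t (J 1 y)) (L s (J 1 y)) ≤ ‖(1 : ℝ) • J 1 y - y‖ * |(t : ℝ) - s| := by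
    intro y s t
    rw [dist_eq_norm]
    exact le_of_tendsto_of_tendsto ((hL t _).sub (hL s _)).norm
      ((hJ.tendsto_yosidaApprox one_pos y).norm.mul_const _)
      (Eventually.of_forall fun n => norm_exp_sub_exp_apply_time_le
        (hJ.norm_exp_yosidaApprox_le n) s.2 t.2 _)
  have hLcont : ∀ u : X, Continuous fun t => L t u := by
    intro u
    have hran : ∀ y : X, Continuous fun t => L t (J 1 y) := by
      intro y
      refine (LipschitzWith.of_dist_le_mul (K := ‖(1 : ℝ) • J 1 y - y‖₊) fun t s => ?_).continuous
      simpa only [NNReal.dist_eq, coe_nnnorm] using hLlip y s t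
    refine continuous_of_uniform_approx_of_continuous fun V hV => ?_
    obtain ⟨ε, hε, hεV⟩ := Metric.mem_uniformity_dist.1 hV
    obtain ⟨_, hy, y, rfl⟩ := Metric.dense_iff.1 hJ.dense_range u ε hε
    refine ⟨_, hran y, fun t => hεV ?_⟩
    rw [Metric.mem_ball, dist_comm] at hy
    refine lt_of_le_of_lt ?_ hy
    rw [dist_eq_norm, dist_eq_norm, ← hT, ← hT, ← map_sub]
    exact hLnorm _ _
  -- Uniform contractivity lets the argument vary with `n`; this serves both the semigroup law and
  -- the integral equation below.
  have hcomp : ∀ (t : ℝ≥0) (v : X) (w : ℕ → X), Tendsto w atTop (𝓝 v) →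
      Tendsto (fun n : ℕ => NormedSpace.exp ((t : ℝ) • yosidaApprox J n) (w n)) atTop
        (𝓝 (L t v)) := by
    intro t v w hw
    have h1 : Tendsto (fun n : ℕ => NormedSpace.exp ((t : ℝ) • yosidaApprox J n) (w n - v))
        atTop (𝓝 0) :=
      squeeze_zero_norm (fun n => hJ.norm_exp_yosidaApprox_le n t t.2 _)
        (tendsto_iff_norm_sub_tendsto_zero.1 hw)
    simpa only [map_sub, sub_add_cancel, zero_add] using h1.add (hL t v)
  let S : C0Semigroup X :=
    { toFun := T
      map_zero' := by
        ext u
        refine tendsto_nhds_unique (hL 0 u) ?_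
        simp
      map_add' := fun s t => by
        ext u
        refine tendsto_nhds_unique (hL (s + t) u) ?_
        refine (hcomp s _ _ (hL t u)).congr fun n => ?_
        rw [NNReal.coe_add, add_smul, NormedSpace.exp_add_of_commute
          (((Commute.refl _).smul_left _).smul_right _), mul_apply_eq_comp]
      continuous' := hLcont }
  refine ⟨S, hLnorm, fun mu hm u => ?_, hL⟩
  set x := J mu u
  set v := mu • x - u
  have hcont : Continuous fun s : ℝ => L s.toNNReal v :=
    (hLcont v).comp continuous_real_toNNReal
  -- The integral equation of the approximating groups passes to the limit, dominated by a bound on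
  -- the convergent sequence `‖yosidaApprox J n x‖`.
  have hint : ∀ t : ℝ≥0, L t x = x + ∫ s in (0 : ℝ)..t, L s.toNNReal v := by
    intro t
    rw [← sub_eq_iff_eq_add']
    refine tendsto_nhds_unique ((hL t x).sub_const x) ?_
    simp only [exp_smul_apply_sub_eq_integral]
    obtain ⟨C, hC⟩ := (hJ.tendsto_yosidaApprox hm u).norm.bddAbove_range
    refine intervalIntegral.tendsto_integral_filter_of_dominated_convergence (fun _ => C)
      (Eventually.of_forall fun n => ?_)
      (Eventually.of_forall fun n => Eventually.of_forall fun s hs => ?_)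
      intervalIntegrable_const (Eventually.of_forall fun s hs => ?_)
    · have : Continuous fun s : ℝ =>
          NormedSpace.exp (s • yosidaApprox J n) (yosidaApprox J n x) :=
        (NormedSpace.exp_continuous.comp (continuous_id.smul continuous_const)).clm_apply
          continuous_const
      exact this.aestronglyMeasurable
    · rw [uIoc_of_le (NNReal.coe_nonneg t)] at hs
      exact (hJ.norm_exp_yosidaApprox_le n s hs.1.le _).trans (hC (mem_range_self n))
    · rw [uIoc_of_le (NNReal.coe_nonneg t)] at hs
      have := hcomp s.toNNReal v _ (hJ.tendsto_yosidaApprox hm u)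
      rwa [Real.coe_toNNReal _ hs.1.le] at this
  refine S.hasGeneratorAt_of_hasDerivAt (F := fun t : ℝ => x + ∫ s in (0 : ℝ)..t, L s.toNNReal v)
    hint ?_
  have h1 := ((hcont.integral_hasStrictDerivAt 0 0).hasDerivAt).const_add x
  have h0 : L 0 v = v := DFunLike.congr_fun S.map_zero' v
  simpa only [Real.toNNReal_zero, h0] using h1

end IsContractionResolvent

/-! ### The perturbation series as a contraction resolvent -/

section Perturbation

variable {X : Type*} [NormedAddCommGroup X] [NormedSpace ℝ X]

/-- `R lam = (lam - A)⁻¹` and `K lam = B (lam - A)⁻¹` for a perturbation `A + B`, where `K lam`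
is a contraction and `∑ ‖R lam (K lam)ⁿ v‖ ≤ ‖v‖ / lam`. -/
structure IsPerturbationPair (R K : ℝ → X →L[ℝ] X) : Prop where
  norm_le : ∀ lam : ℝ, 0 < lam → ∀ v, ‖K lam v‖ ≤ ‖v‖
  summable : ∀ lam : ℝ, 0 < lam → ∀ v, Summable fun n : ℕ => ‖R lam ((K lam ^ n) v)‖
  tsum_le : ∀ lam : ℝ, 0 < lam → ∀ v, ∑' n : ℕ, ‖R lam ((K lam ^ n) v)‖ ≤ lam⁻¹ * ‖v‖
  left_eq : ∀ lam mu : ℝ, 0 < lam → 0 < mu → ∀ v, R mu v = R lam (v + (lam - mu) • R mu v)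
  right_eq : ∀ lam mu : ℝ, 0 < lam → 0 < mu → ∀ v, K mu v = K lam (v + (lam - mu) • R mu v)
  dense_range : Dense (range (R 1))

namespace IsPerturbationPair

variable {R K : ℝ → X →L[ℝ] X}

theorem norm_term_le {lam r : ℝ} (hr0 : 0 ≤ r) (hr1 : r ≤ 1) (n : ℕ) (v : X) :
    ‖r ^ n • R lam ((K lam ^ n) v)‖ ≤ ‖R lam ((K lam ^ n) v)‖ := by
  rw [norm_smul, Real.norm_of_nonneg (by positivity)]
  exact mul_le_of_le_one_left (norm_nonneg _) (pow_le_one₀ hr0 hr1)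

/-- The series is formally `R (1 - rK)⁻¹`, and applying it to `v - rKv` telescopes. This needs only
pointwise convergence, so it remains available at `r = 1`. -/
theorem series_apply_sub {lam r : ℝ} {N : X →L[ℝ] X}
    (hN : ∀ v, HasSum (fun n : ℕ => r ^ n • R lam ((K lam ^ n) v)) (N v)) (v : X) :
    N (v - r • K lam v) = R lam v := by
  have h1 := (hasSum_nat_add_iff' (f := fun n : ℕ => r ^ n • R lam ((K lam ^ n) v)) 1).2 (hN v)
  have h2 := (hN (K lam v)).const_smul r
  have h3 : N v - R lam v = r • N (K lam v) := by
    rw [Finset.sum_range_one, pow_zero, pow_zero, one_smul] at h1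
    refine HasSum.unique h1 (h2.congr_fun fun n => ?_)
    rw [smul_smul, ← pow_succ', pow_succ (K lam), mul_apply_eq_comp]
  rw [map_sub, map_smul, ← h3, sub_sub_cancel]

variable [CompleteSpace X] (h : IsPerturbationPair R K)
include h

theorem summable_term {lam r : ℝ} (hl : 0 < lam) (hr0 : 0 ≤ r) (hr1 : r ≤ 1) (v : X) :
    Summable fun n : ℕ => r ^ n • R lam ((K lam ^ n) v) :=
  Summable.of_norm_bounded (h.summable lam hl v) fun n => norm_term_le hr0 hr1 n v

theorem exists_series {lam r : ℝ} (hl : 0 < lam) (hr0 : 0 ≤ r) (hr1 : r ≤ 1) :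
    ∃ N : X →L[ℝ] X, (∀ v, HasSum (fun n : ℕ => r ^ n • R lam ((K lam ^ n) v)) (N v)) ∧
      ∀ v, ‖N v‖ ≤ lam⁻¹ * ‖v‖ := by
  have hs := h.summable_term hl hr0 hr1
  have hb : ∀ v, ‖∑' n : ℕ, r ^ n • R lam ((K lam ^ n) v)‖ ≤ lam⁻¹ * ‖v‖ := fun v =>
    (tsum_of_norm_bounded (h.summable lam hl v).hasSum
      fun n => norm_term_le hr0 hr1 n v).trans (h.tsum_le lam hl v)
  refine ⟨LinearMap.mkContinuous
    { toFun := fun v => ∑' n : ℕ, r ^ n • R lam ((K lam ^ n) v)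
      map_add' := fun u v => by
        rw [← (hs u).tsum_add (hs v)]
        simp only [map_add, smul_add]
      map_smul' := fun c v => by
        rw [RingHom.id_apply, ← (hs v).tsum_const_smul]
        simp only [map_smul, smul_comm c] } lam⁻¹ hb, fun v => (hs v).hasSum, hb⟩

/-- For `r < 1` the operator `1 - r K mu` is invertible, so `z = v - r K mu v` and `M z = R mu v`.
The compatibility relations rewrite `R mu v` and `K mu v` as `R lam w` and `K lam w` with the same
`w`, whence `N (w - r K lam w) = R mu v`. -/
theorem series_resolvent_eq {lam mu r : ℝ} (hl : 0 < lam) (hm : 0 < mu) (hr0 : 0 ≤ r)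
    (hr1 : r < 1) {N M : X →L[ℝ] X}
    (hN : ∀ v, HasSum (fun n : ℕ => r ^ n • R lam ((K lam ^ n) v)) (N v))
    (hM : ∀ v, HasSum (fun n : ℕ => r ^ n • R mu ((K mu ^ n) v)) (M v)) (z : X) :
    M z = N (z + (lam - mu) • M z) := by
  have hlt : ‖r • K mu‖ < 1 := by
    refine lt_of_le_of_lt ?_ hr1
    rw [norm_smul, Real.norm_of_nonneg hr0]
    refine mul_le_of_le_one_right hr0 (ContinuousLinearMap.opNorm_le_bound _ zero_le_one ?_)
    simpa only [one_mul] using h.norm_le mu hm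
  obtain ⟨U, hU⟩ := isUnit_one_sub_of_norm_lt_one hlt
  obtain ⟨v, rfl⟩ : ∃ v, v - r • K mu v = z := by
    refine ⟨(↑U⁻¹ : X →L[ℝ] X) z, ?_⟩
    have := DFunLike.congr_fun U.mul_inv z
    rw [hU] at this
    exact this
  have h1 := series_apply_sub hM v
  have h2 := series_apply_sub hN (v + (lam - mu) • R mu v)
  rw [← h.left_eq lam mu hl hm, ← h.right_eq lam mu hl hm] at h2
  rw [h1, ← h2]
  congr 1
  rw [h2]
  abel

theorem exists_contractionResolvent :
    ∃ J : ℝ → X →L[ℝ] X, IsContractionResolvent J ∧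
      ∀ lam : ℝ, 0 < lam → ∀ v, HasSum (fun n : ℕ => R lam ((K lam ^ n) v)) (J lam v) := by
  have hex : ∀ lam : ℝ, ∃ N : X →L[ℝ] X, 0 < lam →
      (∀ v, HasSum (fun n : ℕ => R lam ((K lam ^ n) v)) (N v)) ∧ ∀ v, ‖N v‖ ≤ lam⁻¹ * ‖v‖ := by
    intro lam
    rcases lt_or_ge 0 lam with hl | hl
    · obtain ⟨N, hN⟩ := h.exists_series hl zero_le_one le_rfl
      exact ⟨N, fun _ => by simpa only [one_pow, one_smul] using hN⟩
    · exact ⟨0, fun h0 => absurd h0 hl.not_gt⟩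
  choose J hJ using hex
  refine ⟨J, ⟨fun lam hl => (hJ lam hl).2, fun lam mu hl hm z => ?_, ?_⟩, fun lam hl => (hJ lam hl).1⟩
  -- `K` may have norm `1`, so `1 - K` need not be invertible. The resolvent equation is taken from
  -- `r < 1` to `r = 1`, with the summable norms at `r = 1` as dominating series.
  · let r : ℕ → ℝ := fun n => 1 - 1 / ((n : ℝ) + 1)
    have hr0 : ∀ n, 0 ≤ r n := fun n => by
      have : 1 / ((n : ℝ) + 1) ≤ 1 := by
        rw [div_le_one (by positivity)]
        linarith [n.cast_nonneg (α := ℝ)]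
      exact sub_nonneg.2 this
    have hr1 : ∀ n, r n < 1 := fun n => sub_lt_self _ (by positivity)
    have hr : Tendsto r atTop (𝓝 1) := by
      simpa only [sub_zero] using (tendsto_one_div_add_atTop_nhds_zero_nat (𝕜 := ℝ)).const_sub 1
    choose N hN hNb using fun n => h.exists_series hl (hr0 n) (hr1 n).le
    choose M hM _ using fun n => h.exists_series hm (hr0 n) (hr1 n).le
    have hlim : ∀ {nu : ℝ} (hn : 0 < nu) {Q : ℕ → X →L[ℝ] X}
        (hQ : ∀ n v, HasSum (fun k : ℕ => r n ^ k • R nu ((K nu ^ k) v)) (Q n v)) (v : X),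
        Tendsto (fun n => Q n v) atTop (𝓝 (J nu v)) := by
      intro nu hn Q hQ v
      have := tendsto_tsum_of_dominated_convergence (𝓕 := atTop)
        (f := fun n (k : ℕ) => r n ^ k • R nu ((K nu ^ k) v))
        (g := fun k => R nu ((K nu ^ k) v)) (h.summable nu hn v)
        (fun k => by simpa using (hr.pow k).smul_const (R nu ((K nu ^ k) v)))
        (Eventually.of_forall fun n k => norm_term_le (hr0 n) (hr1 n).le k v)
      rw [((hJ nu hn).1 v).tsum_eq] at this
      exact this.congr fun n => (hQ n v).tsum_eq
    have hMz := hlim hm hM z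
    have hy := (hMz.const_smul (lam - mu)).const_add z
    -- Both the operator and its argument depend on `n`; the bound `lam⁻¹` on `N n`, uniform in `n`,
    -- separates the two limits.
    have h1 : Tendsto (fun n => N n ((z + (lam - mu) • M n z) - (z + (lam - mu) • J mu z)))
        atTop (𝓝 0) := by
      have := (tendsto_iff_norm_sub_tendsto_zero.1 hy).const_mul lam⁻¹
      rw [mul_zero] at this
      exact squeeze_zero_norm (fun n => hNb n _) this
    have h2 := h1.add (hlim hl hN (z + (lam - mu) • J mu z))
    simp only [map_sub, sub_add_cancel, zero_add] at h2
    exact tendsto_nhds_unique hMz (h2.congr fun n =>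
      (h.series_resolvent_eq hl hm (hr0 n) (hr1 n) (hN n) (hM n) z).symm)
  -- Since `J 1 (v - K 1 v) = R 1 v`, the range of `J 1` contains that of `R 1`.
  · refine h.dense_range.mono ?_
    rintro _ ⟨v, rfl⟩
    have := series_apply_sub (R := R) (K := K) (lam := 1) (r := 1) (N := J 1)
      (by simpa only [one_pow, one_smul] using (hJ 1 one_pos).1) v
    exact ⟨_, this⟩

end IsPerturbationPair

end Perturbation

/-! ### Order and integral on `L¹` -/

section L1Order

variable {E : Type*} [MeasurableSpace E] {m : Measure E}

instance Lp.instIsOrderedModuleReal {p : ℝ≥0∞} : IsOrderedModule ℝ (Lp ℝ p m) :=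
  IsOrderedModule.of_smul_nonneg fun c hc u hu => by
    rw [← Lp.coeFn_nonneg] at hu ⊢
    filter_upwards [hu, Lp.coeFn_smul c u] with x hx hs
    rw [hs]
    exact mul_nonneg hc hx

namespace L1

theorem integralCLM_apply (u : Lp ℝ 1 m) :
    (L1.integralCLM (E := ℝ) : Lp ℝ 1 m →L[ℝ] ℝ) u = ∫ x, u x ∂m := by
  rw [← L1.integral_eq_integral, L1.integral_def]

theorem integral_coeFn_add (u v : Lp ℝ 1 m) :
    ∫ x, (u + v : Lp ℝ 1 m) x ∂m = ∫ x, u x ∂m + ∫ x, v x ∂m := by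
  simp only [← integralCLM_apply, map_add]

theorem integral_coeFn_sub (u v : Lp ℝ 1 m) :
    ∫ x, (u - v : Lp ℝ 1 m) x ∂m = ∫ x, u x ∂m - ∫ x, v x ∂m := by
  simp only [← integralCLM_apply, map_sub]

theorem integral_coeFn_smul (c : ℝ) (u : Lp ℝ 1 m) :
    ∫ x, (c • u : Lp ℝ 1 m) x ∂m = c * ∫ x, u x ∂m := by
  simp only [← integralCLM_apply, map_smul, smul_eq_mul]

theorem integral_coeFn_nonneg {u : Lp ℝ 1 m} (hu : 0 ≤ u) : 0 ≤ ∫ x, u x ∂m :=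
  integral_nonneg_of_ae ((Lp.coeFn_nonneg u).2 hu)

theorem norm_eq_integral_of_nonneg {u : Lp ℝ 1 m} (hu : 0 ≤ u) : ‖u‖ = ∫ x, u x ∂m := by
  rw [L1.norm_eq_integral_norm]
  refine integral_congr_ae ?_
  filter_upwards [(Lp.coeFn_nonneg u).2 hu] with x hx
  exact Real.norm_of_nonneg hx

theorem norm_posPart_add_norm_negPart (u : Lp ℝ 1 m) : ‖u⁺‖ + ‖u⁻‖ = ‖u‖ := by
  rw [← norm_abs_eq_norm u, ← posPart_add_negPart u,
    norm_eq_integral_of_nonneg (posPart_nonneg u), norm_eq_integral_of_nonneg (negPart_nonneg u),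
    norm_eq_integral_of_nonneg (add_nonneg (posPart_nonneg u) (negPart_nonneg u)),
    integral_coeFn_add]

/-- A subadditive even functional is bounded on `L¹` by a multiple of the norm if it is so on
the positive cone. -/
theorem le_mul_norm_of_nonneg {F : Lp ℝ 1 m → ℝ} (hsub : ∀ u v, F (u - v) ≤ F u + F v) {c : ℝ}
    (hF : ∀ u, 0 ≤ u → F u ≤ c * ‖u‖) (u : Lp ℝ 1 m) : F u ≤ c * ‖u‖ := by
  rw [← norm_posPart_add_norm_negPart u, mul_add]
  calc F u = F (u⁺ - u⁻) := by rw [posPart_sub_negPart]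
    _ ≤ F u⁺ + F u⁻ := hsub _ _
    _ ≤ _ := add_le_add (hF _ (posPart_nonneg u)) (hF _ (negPart_nonneg u))

/-- Two additive functionals that agree on the positive cone agree. -/
theorem eq_of_eq_on_nonneg {Y : Type*} [AddCommGroup Y] {F G : Lp ℝ 1 m → Y}
    (hF : ∀ u v, F (u - v) = F u - F v) (hG : ∀ u v, G (u - v) = G u - G v)
    (h : ∀ u, 0 ≤ u → F u = G u) (u : Lp ℝ 1 m) : F u = G u := by
  rw [← posPart_sub_negPart u, hF, hG, h _ (posPart_nonneg u), h _ (negPart_nonneg u)]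

end L1

theorem ContinuousLinearMap.pow_apply_nonneg {T : Lp ℝ 1 m →L[ℝ] Lp ℝ 1 m}
    (hT : ∀ u, 0 ≤ u → 0 ≤ T u) (n : ℕ) {u : Lp ℝ 1 m} (hu : 0 ≤ u) : 0 ≤ (T ^ n) u := by
  induction n with
  | zero => exact hu
  | succ k ih => rw [pow_succ', mul_apply_eq_comp]; exact hT _ ih

theorem C0Semigroup.IsSubstochastic.isContraction {S : C0Semigroup (Lp ℝ 1 m)}
    (hS : S.IsSubstochastic) : S.IsContraction := hS.2

theorem C0Semigroup.IsSubstochastic.laplace_nonneg {S : C0Semigroup (Lp ℝ 1 m)}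
    (hS : S.IsSubstochastic) {lam : ℝ} (h : 0 < lam) {u : Lp ℝ 1 m} (hu : 0 ≤ u) :
    0 ≤ S.laplace hS.isContraction h u := by
  rw [S.laplace_apply]
  exact integral_nonneg fun t => smul_nonneg (Real.exp_nonneg _) (hS.1 _ _ hu)

end L1Order

/-! ### The operators `R(λ, A)` and `B R(λ, A)` -/

section KatoPair

variable {E : Type*} [MeasurableSpace E] {m : Measure E}

/-- The resolvent `R lam` of the generator `A` of a substochastic semigroup and the operator
`K lam = B R lam`, in the setting of Kato's perturbation theorem. -/
structure IsKatoPair (A B : Lp ℝ 1 m →ₗ.[ℝ] Lp ℝ 1 m) (R K : ℝ → Lp ℝ 1 m →L[ℝ] Lp ℝ 1 m) :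
    Prop where
  left_nonneg : ∀ lam : ℝ, 0 < lam → ∀ v, 0 ≤ v → 0 ≤ R lam v
  right_nonneg : ∀ lam : ℝ, 0 < lam → ∀ v, 0 ≤ v → 0 ≤ K lam v
  opBR_eq : ∀ lam : ℝ, 0 < lam → ∀ v, opBR A B lam v = K lam v
  integral_left : ∀ lam : ℝ, 0 < lam → ∀ v,
    lam * ∫ x, R lam v x ∂m = ∫ x, v x ∂m - ∫ x, K lam v x ∂m
  left_resolvent : ∀ (lam : ℝ), 0 < lam → ∀ u : A.domain, R lam (lam • (u : Lp ℝ 1 m) - A u) = u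
  left_mem : ∀ (lam : ℝ), 0 < lam → ∀ v, ∃ (hA : R lam v ∈ A.domain) (hB : R lam v ∈ B.domain),
    A ⟨R lam v, hA⟩ = lam • R lam v - v ∧ B ⟨R lam v, hB⟩ = K lam v
  dense_domain : Dense (A.domain : Set (Lp ℝ 1 m))

theorem exists_isKatoPair {A B : Lp ℝ 1 m →ₗ.[ℝ] Lp ℝ 1 m} {S : C0Semigroup (Lp ℝ 1 m)}
    (hS : S.IsSubstochastic) (hSA : S.generator = A) (hAB : A.domain ≤ B.domain)
    (hG2 : ∀ (u : Lp ℝ 1 m) (hu : u ∈ A.domain), 0 ≤ u → 0 ≤ B ⟨u, hAB hu⟩)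
    (hG3 : ∀ (u : Lp ℝ 1 m) (hu : u ∈ A.domain), 0 ≤ u →
      ∫ x, (A ⟨u, hu⟩ + B ⟨u, hAB hu⟩ : Lp ℝ 1 m) x ∂m = 0) :
    ∃ R K : ℝ → Lp ℝ 1 m →L[ℝ] Lp ℝ 1 m, IsKatoPair A B R K := by
  have hres : ∀ lam : ℝ, 0 < lam → IsResolventAt A lam (resolventOp A lam) := by
    intro lam hl
    rw [← hSA, S.resolventOp_generator hS.isContraction hl]
    exact S.isResolventAt_laplace hS.isContraction hl
  have hRpos : ∀ lam : ℝ, 0 < lam → ∀ v, 0 ≤ v → 0 ≤ resolventOp A lam v := by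
    intro lam hl v hv
    rw [← hSA, S.resolventOp_generator hS.isContraction hl]
    exact hS.laplace_nonneg hl hv
  have hmemA : ∀ lam : ℝ, 0 < lam → ∀ v, resolventOp A lam v ∈ A.domain :=
    fun lam hl v => ((hres lam hl).1 v).1
  have hBR : ∀ (lam : ℝ) (hl : 0 < lam) (v : Lp ℝ 1 m),
      opBR A B lam v = B ⟨resolventOp A lam v, hAB (hmemA lam hl v)⟩ := by
    intro lam hl v
    have hm : ∀ w, (resolventOp A lam : Lp ℝ 1 m →ₗ[ℝ] Lp ℝ 1 m) w ∈ B.domain :=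
      fun w => hAB (hmemA lam hl w)
    rw [opBR, dif_pos hm]
    rfl
  have hKpos : ∀ lam : ℝ, 0 < lam → ∀ v, 0 ≤ v → 0 ≤ opBR A B lam v := by
    intro lam hl v hv
    rw [hBR lam hl]
    exact hG2 _ (hmemA lam hl v) (hRpos lam hl v hv)
  have hA : ∀ (lam : ℝ) (hl : 0 < lam) (v : Lp ℝ 1 m),
      A ⟨resolventOp A lam v, hmemA lam hl v⟩ = lam • resolventOp A lam v - v := by
    intro lam hl v
    obtain ⟨_, he⟩ := (hres lam hl).1 v
    exact eq_sub_of_add_eq' (sub_eq_iff_eq_add.1 he).symm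
  -- This is (G3) at `R v`, first for `v ≥ 0` and then by linearity. With `R v ≥ 0` it bounds `B R`
  -- by `1` on the cone, so `B R` is bounded although nothing is assumed about `B` beyond
  -- positivity.
  have hint : ∀ lam : ℝ, 0 < lam → ∀ v, lam * ∫ x, resolventOp A lam v x ∂m =
      ∫ x, v x ∂m - ∫ x, opBR A B lam v x ∂m := by
    intro lam hl
    refine L1.eq_of_eq_on_nonneg (fun u v => ?_) (fun u v => ?_) fun v hv => ?_
    · rw [map_sub, L1.integral_coeFn_sub, mul_sub]
    · rw [map_sub, L1.integral_coeFn_sub, L1.integral_coeFn_sub]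
      ring
    · have := hG3 _ (hmemA lam hl v) (hRpos lam hl v hv)
      rw [← hBR lam hl, hA lam hl, L1.integral_coeFn_add, L1.integral_coeFn_sub,
        L1.integral_coeFn_smul] at this
      linarith
  have hKnorm : ∀ lam : ℝ, 0 < lam → ∀ v, ‖opBR A B lam v‖ ≤ 1 * ‖v‖ := by
    intro lam hl
    refine L1.le_mul_norm_of_nonneg (fun u v => ?_) fun v hv => ?_
    · rw [map_sub]
      exact norm_sub_le _ _
    · rw [one_mul, L1.norm_eq_integral_of_nonneg hv, L1.norm_eq_integral_of_nonneg
        (hKpos lam hl v hv)]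
      have h1 := hint lam hl v
      have h2 := mul_nonneg hl.le (L1.integral_coeFn_nonneg (hRpos lam hl v hv))
      linarith
  have hex : ∀ lam : ℝ, ∃ K : Lp ℝ 1 m →L[ℝ] Lp ℝ 1 m, 0 < lam → ∀ v, opBR A B lam v = K v := by
    intro lam
    rcases lt_or_ge 0 lam with hl | hl
    · exact ⟨LinearMap.mkContinuous (opBR A B lam) 1 (hKnorm lam hl), fun _ _ => rfl⟩
    · exact ⟨0, fun h0 => absurd h0 hl.not_gt⟩
  choose K hK using hex
  refine ⟨resolventOp A, K, hRpos, fun lam hl v hv => ?_, hK, fun lam hl v => ?_,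
    fun lam hl => (hres lam hl).2, fun lam hl v => ⟨hmemA lam hl v, hAB (hmemA lam hl v),
      hA lam hl v, ?_⟩, ?_⟩
  · rw [← hK lam hl]
    exact hKpos lam hl v hv
  · rw [← hK lam hl]
    exact hint lam hl v
  · rw [← hK lam hl, hBR lam hl]
  · rw [← hSA]
    exact S.dense_generator_domain hS.isContraction

namespace IsKatoPair

variable {A B : Lp ℝ 1 m →ₗ.[ℝ] Lp ℝ 1 m} {R K : ℝ → Lp ℝ 1 m →L[ℝ] Lp ℝ 1 m}
  (h : IsKatoPair A B R K)
include h

theorem integral_sum_range {lam : ℝ} (hl : 0 < lam) (v : Lp ℝ 1 m) (N : ℕ) :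
    lam * ∑ n ∈ Finset.range N, ∫ x, R lam ((K lam ^ n) v) x ∂m =
      ∫ x, v x ∂m - ∫ x, (K lam ^ N) v x ∂m := by
  induction N with
  | zero => simp
  | succ N ih =>
    rw [Finset.sum_range_succ, mul_add, ih, h.integral_left lam hl, pow_succ', mul_apply_eq_comp]
    ring

/-- For `v ≥ 0` every norm is an integral, and the telescoped identity bounds the sum once the
nonnegative remainder `∫ K^N v` is dropped. Positive and negative parts give general `v` with the
same constant, because the `L¹` norm is additive on them. -/
theorem sum_range_norm_le {lam : ℝ} (hl : 0 < lam) (v : Lp ℝ 1 m) (N : ℕ) :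
    ∑ n ∈ Finset.range N, ‖R lam ((K lam ^ n) v)‖ ≤ lam⁻¹ * ‖v‖ := by
  refine L1.le_mul_norm_of_nonneg (F := fun v => ∑ n ∈ Finset.range N, ‖R lam ((K lam ^ n) v)‖)
    (fun u v => ?_) (fun v hv => ?_) v
  · rw [← Finset.sum_add_distrib]
    refine Finset.sum_le_sum fun n _ => ?_
    rw [map_sub, map_sub]
    exact norm_sub_le _ _
  · have hpow := fun n => ContinuousLinearMap.pow_apply_nonneg (h.right_nonneg lam hl) n hv
    have h1 : ∀ n, ‖R lam ((K lam ^ n) v)‖ = ∫ x, R lam ((K lam ^ n) v) x ∂m := fun n =>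
      L1.norm_eq_integral_of_nonneg (h.left_nonneg lam hl _ (hpow n))
    simp only [h1]
    rw [← div_eq_inv_mul, le_div_iff₀' hl, h.integral_sum_range hl,
      L1.norm_eq_integral_of_nonneg hv]
    exact sub_le_self _ (L1.integral_coeFn_nonneg (hpow N))

theorem norm_right_le {lam : ℝ} (hl : 0 < lam) (v : Lp ℝ 1 m) : ‖K lam v‖ ≤ ‖v‖ := by
  rw [← one_mul ‖v‖]
  refine L1.le_mul_norm_of_nonneg (F := fun v => ‖K lam v‖) (fun u v => ?_) (fun v hv => ?_) v
  · rw [map_sub]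
    exact norm_sub_le _ _
  · rw [one_mul, L1.norm_eq_integral_of_nonneg hv,
      L1.norm_eq_integral_of_nonneg (h.right_nonneg lam hl v hv)]
    have h1 := h.integral_left lam hl v
    have h2 := mul_nonneg hl.le (L1.integral_coeFn_nonneg (h.left_nonneg lam hl v hv))
    linarith

theorem left_compat {lam mu : ℝ} (hl : 0 < lam) (hm : 0 < mu) (v : Lp ℝ 1 m) :
    R mu v = R lam (v + (lam - mu) • R mu v) := by
  obtain ⟨hA, _, he, _⟩ := h.left_mem mu hm v
  have := h.left_resolvent lam hl ⟨_, hA⟩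
  rw [he] at this
  refine this.symm.trans (congrArg _ ?_)
  change lam • R mu v - (mu • R mu v - v) = _
  module

theorem right_compat {lam mu : ℝ} (hl : 0 < lam) (hm : 0 < mu) (v : Lp ℝ 1 m) :
    K mu v = K lam (v + (lam - mu) • R mu v) := by
  obtain ⟨_, hB, _, he⟩ := h.left_mem mu hm v
  obtain ⟨_, hB', _, he'⟩ := h.left_mem lam hl (v + (lam - mu) • R mu v)
  rw [← he, ← he']
  congr 2
  exact h.left_compat hl hm v

theorem isPerturbationPair : IsPerturbationPair R K where
  norm_le _ hl := h.norm_right_le hl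
  summable _ hl v := summable_of_sum_range_le (fun _ => norm_nonneg _) (h.sum_range_norm_le hl v)
  tsum_le _ hl v := Real.tsum_le_of_sum_range_le (fun _ => norm_nonneg _)
    (h.sum_range_norm_le hl v)
  left_eq _ _ hl hm := h.left_compat hl hm
  right_eq _ _ hl hm := h.right_compat hl hm
  dense_range := h.dense_domain.mono fun u hu => ⟨_, h.left_resolvent 1 one_pos ⟨u, hu⟩⟩

end IsKatoPair

end KatoPair

/-! ### Kato's semigroup and the resolvent of the minimal semigroup -/

section KatoSemigroup

variable {E : Type*} [MeasurableSpace E] {m : Measure E}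

/-- The negative multiple of the identity contributes only a positive scalar factor; what remains is
a power series in a positive operator. -/
theorem exp_yosidaApprox_apply_nonneg {J : ℝ → Lp ℝ 1 m →L[ℝ] Lp ℝ 1 m}
    (hJ : ∀ lam : ℝ, 0 < lam → ∀ v, 0 ≤ v → 0 ≤ J lam v) (n : ℕ) {t : ℝ} (ht : 0 ≤ t)
    {u : Lp ℝ 1 m} (hu : 0 ≤ u) : 0 ≤ NormedSpace.exp (t • yosidaApprox J n) u := by
  rw [yosidaApprox, exp_smul_sub_smul_one, smul_apply]
  refine smul_nonneg (Real.exp_nonneg _) ((hasSum_exp_apply _ u).nonneg fun k => ?_)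
  have hT : ∀ v : Lp ℝ 1 m, 0 ≤ v → 
      0 ≤ (t • (((n : ℝ) + 1) ^ 2 • J (n + 1)) : Lp ℝ 1 m →L[ℝ] Lp ℝ 1 m) v := fun v hv =>
    smul_nonneg ht (smul_nonneg (sq_nonneg ((n : ℝ) + 1)) (hJ _ (Nat.cast_add_one_pos n) v hv))
  exact smul_nonneg (inv_nonneg.2 (Nat.cast_nonneg _)) (ContinuousLinearMap.pow_apply_nonneg hT k hu)

namespace IsKatoPair

variable {A B : Lp ℝ 1 m →ₗ.[ℝ] Lp ℝ 1 m} {R K : ℝ → Lp ℝ 1 m →L[ℝ] Lp ℝ 1 m}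
  (h : IsKatoPair A B R K)
include h

/-- **Kato's theorem**: there is a substochastic semigroup whose generator extends `A + B` and
whose resolvent is `∑ R lam (K lam)ⁿ`. -/
theorem exists_katoSemigroup :
    ∃ (Q : C0Semigroup (Lp ℝ 1 m)) (hQ : Q.IsSubstochastic), A + B ≤ Q.generator ∧
      ∀ (lam : ℝ) (hl : 0 < lam) (v : Lp ℝ 1 m),
        HasSum (fun n : ℕ => R lam ((K lam ^ n) v)) (Q.laplace hQ.isContraction hl v) := by
  obtain ⟨J, hJ, hsum⟩ := h.isPerturbationPair.exists_contractionResolvent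
  obtain ⟨Q, hQc, hgen, hlim⟩ := hJ.exists_semigroup
  have hJpos : ∀ lam : ℝ, 0 < lam → ∀ v, 0 ≤ v → 0 ≤ J lam v := fun lam hl v hv =>
    (hsum lam hl v).nonneg fun n => h.left_nonneg lam hl _
      (ContinuousLinearMap.pow_apply_nonneg (h.right_nonneg lam hl) n hv)
  have hQ : Q.IsSubstochastic := ⟨fun t u hu => ge_of_tendsto (hlim t u)
    (Eventually.of_forall fun n => exp_yosidaApprox_apply_nonneg hJpos n t.2 hu), hQc⟩
  refine ⟨Q, hQ, ?_, fun lam hl v => ?_⟩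
  · have key : ∀ (u : Lp ℝ 1 m) (hA : u ∈ A.domain) (hB : u ∈ B.domain),
        Q.HasGeneratorAt u (A ⟨u, hA⟩ + B ⟨u, hB⟩) := by
      intro u hA hB
      have h1 := h.left_resolvent 1 one_pos ⟨u, hA⟩
      obtain ⟨_, hB', _, he⟩ := h.left_mem 1 one_pos ((1 : ℝ) • u - A ⟨u, hA⟩)
      have h2 : B ⟨u, hB⟩ = K 1 ((1 : ℝ) • u - A ⟨u, hA⟩) := by
        rw [← he]
        congr 2
        exact h1.symm
      -- With `w = u - A u` one has `R 1 w = u` and `K 1 w = B u`. Hence `J 1 (w - K 1 w) = u`, and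
      -- the generator at `u` is `u - (w - B u) = A u + B u`.
      have h3 := IsPerturbationPair.series_apply_sub (R := R) (K := K) (lam := 1) (r := 1)
        (N := J 1) (by simpa only [one_pow, one_smul] using hsum 1 one_pos)
        ((1 : ℝ) • u - A ⟨u, hA⟩)
      have h4 := hgen 1 one_pos
        ((1 : ℝ) • u - A ⟨u, hA⟩ - (1 : ℝ) • K 1 ((1 : ℝ) • u - A ⟨u, hA⟩))
      rw [h3, h1, ← h2] at h4
      convert h4 using 1
      module
    refine ⟨fun u hu => (Q.generator_apply (key u hu.1 hu.2)).1, fun u w huw => ?_⟩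
    obtain ⟨hw, he⟩ := Q.generator_apply (key u u.2.1 u.2.2)
    have : w = ⟨u, hw⟩ := Subtype.ext huw.symm
    rw [this, he]
    rfl
  · have := Q.laplace_of_hasGeneratorAt hQ.isContraction hl (hgen lam hl v)
    rw [sub_sub_cancel] at this
    rw [this]
    exact hsum lam hl v

theorem laplace_apply_sub {P : C0Semigroup (Lp ℝ 1 m)} (hP : P.IsSubstochastic)
    (hext : A + B ≤ P.generator) {lam : ℝ} (hl : 0 < lam) (v : Lp ℝ 1 m) :
    P.laplace hP.isContraction hl (v - K lam v) = R lam v := by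
  obtain ⟨hA, hB, heA, heB⟩ := h.left_mem lam hl v
  have hmem : R lam v ∈ (A + B).domain := ⟨hA, hB⟩
  have h1 := P.hasGeneratorAt_generator ⟨_, hext.1 hmem⟩
  have h2 : P.generator ⟨R lam v, hext.1 hmem⟩ = lam • R lam v - v + K lam v := by
    rw [← heA, ← heB]
    exact (hext.2 (x := ⟨R lam v, hmem⟩) (y := ⟨R lam v, hext.1 hmem⟩) rfl).symm
  rw [h2] at h1
  have h3 := P.laplace_of_hasGeneratorAt hP.isContraction hl h1
  refine Eq.trans (congrArg _ ?_) h3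
  abel

/-- Iterating `L v = R v + L (K v)`, with `L` the resolvent of the extension, leaves the remainder
`L (K^N v)`, which is nonnegative. -/
theorem sum_range_le_laplace {P : C0Semigroup (Lp ℝ 1 m)} (hP : P.IsSubstochastic)
    (hext : A + B ≤ P.generator) {lam : ℝ} (hl : 0 < lam) {v : Lp ℝ 1 m} (hv : 0 ≤ v) (N : ℕ) :
    ∑ n ∈ Finset.range N, R lam ((K lam ^ n) v) ≤ P.laplace hP.isContraction hl v := by
  have key : P.laplace hP.isContraction hl v = ∑ n ∈ Finset.range N, R lam ((K lam ^ n) v) +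
      P.laplace hP.isContraction hl ((K lam ^ N) v) := by
    induction N with
    | zero => simp
    | succ N ih =>
      rw [ih, Finset.sum_range_succ, add_assoc, ← h.laplace_apply_sub hP hext hl, map_sub,
        pow_succ' (K lam), mul_apply_eq_comp]
      abel
  rw [key]
  exact le_add_of_nonneg_right (hP.laplace_nonneg hl
    (ContinuousLinearMap.pow_apply_nonneg (h.right_nonneg lam hl) N hv))

/-- The resolvent of the minimal semigroup is `∑ R lam (K lam)ⁿ`. -/
theorem hasSum_laplace {P : C0Semigroup (Lp ℝ 1 m)} (hP : IsMinimalKatoVoigt A B P) {lam : ℝ}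
    (hl : 0 < lam) (v : Lp ℝ 1 m) :
    HasSum (fun n : ℕ => R lam ((K lam ^ n) v)) (P.laplace hP.1.1.isContraction hl v) := by
  obtain ⟨Q, hQ, hQext, hsum⟩ := h.exists_katoSemigroup
  have heq : P.laplace hP.1.1.isContraction hl v = Q.laplace hQ.isContraction hl v := by
    -- One inequality is minimality of `P` under the Laplace integral; the other is the bound on
    -- partial sums, applied to `P` itself.
    refine L1.eq_of_eq_on_nonneg (fun u w => map_sub _ u w) (fun u w => map_sub _ u w)
      (fun u hu => le_antisymm ?_ ?_) v
    · rw [P.laplace_apply, Q.laplace_apply]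
      refine integral_mono (hP.1.1.isContraction.integrableOn_laplaceIntegrand hl u)
        (hQ.isContraction.integrableOn_laplaceIntegrand hl u) fun t => ?_
      exact smul_le_smul_of_nonneg_left (hP.2 Q hQ hQext _ u hu) (Real.exp_nonneg _)
    · exact le_of_tendsto (hsum lam hl u).tendsto_sum_nat
        (Eventually.of_forall (h.sum_range_le_laplace hP.1.1 hP.1.2 hl hu))
  rw [heq]
  exact hsum lam hl v

end IsKatoPair

end KatoSemigroup

/-! ### Abel means and their limits -/

section AbelMean

/-- The Abel mean `lam ∫₀^∞ e^{-lam t} φ(t) dt`, in the form `∫₀^∞ e^{-s} φ(s / lam) ds`. -/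
noncomputable def abelMean (φ : ℝ → ℝ) (lam : ℝ) : ℝ :=
  ∫ s in Ioi (0 : ℝ), Real.exp (-s) * φ (lam⁻¹ * s)

theorem mul_integral_exp_neg_mul_eq_abelMean (φ : ℝ → ℝ) {lam : ℝ} (h : 0 < lam) :
    lam * ∫ t in Ioi (0 : ℝ), Real.exp (-(lam * t)) * φ t = abelMean φ lam := by
  have := integral_comp_mul_left_Ioi (fun t => Real.exp (-(lam * t)) * φ t) 0 (inv_pos.2 h)
  rw [mul_zero, inv_inv, smul_eq_mul] at this
  rw [abelMean, ← this]
  simp only [mul_inv_cancel_left₀ h.ne']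

theorem integrableOn_exp_neg_mul_const (C : ℝ) :
    IntegrableOn (fun s : ℝ => Real.exp (-s) * C) (Ioi 0) := by
  have := (integrableOn_exp_neg_mul_Ioi_zero one_pos).mul_const C
  simp only [one_mul] at this
  exact this

variable {φ : ℝ → ℝ} {C : ℝ}

theorem integrableOn_abelMean (hφ : Continuous φ) (hC : ∀ t, ‖φ t‖ ≤ C) (a : ℝ) :
    IntegrableOn (fun s : ℝ => Real.exp (-s) * φ (a * s)) (Ioi 0) := by
  refine (integrableOn_exp_neg_mul_const C).mono' (Continuous.aestronglyMeasurable (by fun_prop))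
    (Eventually.of_forall fun s => ?_)
  rw [norm_mul, Real.norm_eq_abs, Real.abs_exp]
  gcongr
  exact hC _

/-- In the rescaled form the weight `e^{-s}` does not depend on `lam`, and `s / lam` decreases in
`lam`. -/
theorem abelMean_mono (hφ : Continuous φ) (hC : ∀ t, ‖φ t‖ ≤ C) (hanti : Antitone φ)
    {lam mu : ℝ} (hl : 0 < lam) (hlm : lam ≤ mu) : abelMean φ lam ≤ abelMean φ mu := by
  refine setIntegral_mono_on (integrableOn_abelMean hφ hC _) (integrableOn_abelMean hφ hC _)
    measurableSet_Ioi fun s hs => ?_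
  refine mul_le_mul_of_nonneg_left (hanti ?_) (Real.exp_nonneg _)
  exact mul_le_mul_of_nonneg_right (inv_anti₀ hl hlm) (le_of_lt hs)

theorem tendsto_abelMean_of_forall_tendsto (hφ : Continuous φ) (hC : ∀ t, ‖φ t‖ ≤ C)
    {l : Filter ℝ} [l.IsCountablyGenerated] {ψ : ℝ → ℝ}
    (h : ∀ s : ℝ, 0 < s → Tendsto (fun lam => φ (lam⁻¹ * s)) l (𝓝 (ψ s))) :
    Tendsto (abelMean φ) l (𝓝 (∫ s in Ioi (0 : ℝ), Real.exp (-s) * ψ s)) := by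
  refine tendsto_integral_filter_of_dominated_convergence _
    (Eventually.of_forall fun lam => Continuous.aestronglyMeasurable (by fun_prop))
    (Eventually.of_forall fun lam => Eventually.of_forall fun s => ?_)
    (integrableOn_exp_neg_mul_const C) ((ae_restrict_mem measurableSet_Ioi).mono fun s hs => ?_)
  · rw [norm_mul, Real.norm_eq_abs, Real.abs_exp]
    gcongr
    exact hC _
  · exact (h s hs).const_mul _

theorem tendsto_abelMean_nhds (hφ : Continuous φ) (hC : ∀ t, ‖φ t‖ ≤ C) {lam : ℝ}
    (hl : 0 < lam) : Tendsto (abelMean φ) (𝓝 lam) (𝓝 (abelMean φ lam)) :=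
  tendsto_abelMean_of_forall_tendsto hφ hC fun s _ =>
    (hφ.tendsto _).comp ((tendsto_inv₀ hl.ne').mul_const s)

theorem tendsto_abelMean_nhdsGT_zero (hφ : Continuous φ) (hC : ∀ t, ‖φ t‖ ≤ C) {l : ℝ}
    (h : Tendsto φ atTop (𝓝 l)) : Tendsto (abelMean φ) (𝓝[>] 0) (𝓝 l) := by
  have := tendsto_abelMean_of_forall_tendsto (l := 𝓝[>] 0) (ψ := fun _ => l) hφ hC
    fun s hs => h.comp (tendsto_inv_nhdsGT_zero.atTop_mul_const hs)
  rw [integral_mul_const] at this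
  have h1 := integral_exp_neg_mul_Ioi_zero one_pos
  simp only [one_mul, inv_one] at h1
  rwa [h1, one_mul] at this

end AbelMean

/-! ### Mass along orbits of a substochastic semigroup -/

namespace C0Semigroup

variable {E : Type*} [MeasurableSpace E] {m : Measure E}

/-- The total mass `∫ P(t) u dm` along an orbit. -/
noncomputable def mass (P : C0Semigroup (Lp ℝ 1 m)) (u : Lp ℝ 1 m) (t : ℝ) : ℝ :=
  ∫ x, P t.toNNReal u x ∂m

variable {P : C0Semigroup (Lp ℝ 1 m)} (hP : P.IsSubstochastic)

theorem continuous_mass (P : C0Semigroup (Lp ℝ 1 m)) (u : Lp ℝ 1 m) : Continuous (P.mass u) := by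
  unfold mass
  simp only [← L1.integralCLM_apply]
  exact (ContinuousLinearMap.continuous _).comp
    ((P.continuous' u).comp continuous_real_toNNReal)

include hP

theorem IsSubstochastic.mass_eq_norm {u : Lp ℝ 1 m} (hu : 0 ≤ u) (t : ℝ) :
    P.mass u t = ‖P t.toNNReal u‖ :=
  (L1.norm_eq_integral_of_nonneg (hP.1 _ _ hu)).symm

theorem IsSubstochastic.norm_mass_le {u : Lp ℝ 1 m} (hu : 0 ≤ u) (t : ℝ) :
    ‖P.mass u t‖ ≤ ‖u‖ := by
  rw [hP.mass_eq_norm hu, norm_norm]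
  exact hP.2 _ _

theorem IsSubstochastic.antitone_mass {u : Lp ℝ 1 m} (hu : 0 ≤ u) : Antitone (P.mass u) := by
  intro s t hst
  rw [hP.mass_eq_norm hu, hP.mass_eq_norm hu,
    ← tsub_add_cancel_of_le (Real.toNNReal_le_toNNReal hst), P.map_add']
  exact hP.2 _ _

theorem IsSubstochastic.exists_tendsto_mass {u : Lp ℝ 1 m} (hu : 0 ≤ u) :
    ∃ l : ℝ, Tendsto (P.mass u) atTop (𝓝 l) := by
  refine ⟨_, tendsto_atTop_ciInf (hP.antitone_mass hu) ⟨0, ?_⟩⟩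
  rintro _ ⟨t, rfl⟩
  rw [hP.mass_eq_norm hu]
  exact norm_nonneg _

theorem IsSubstochastic.stronglyStable_iff :
    P.StronglyStable ↔ ∀ u : Lp ℝ 1 m, 0 ≤ u → Tendsto (P.mass u) atTop (𝓝 0) := by
  constructor
  · intro h u hu
    exact ((h u).comp tendsto_real_toNNReal_atTop).congr fun t => (hP.mass_eq_norm hu t).symm
  · intro h u
    have key : ∀ v : Lp ℝ 1 m, 0 ≤ v → Tendsto (fun t : ℝ≥0 => ‖P t v‖) atTop (𝓝 0) := by
      intro v hv
      refine ((h v hv).comp (NNReal.tendsto_coe_atTop.2 tendsto_id)).congr fun t => ?_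
      simp [hP.mass_eq_norm hv]
    have h2 := (key _ (posPart_nonneg u)).add (key _ (negPart_nonneg u))
    rw [add_zero] at h2
    refine squeeze_zero (fun _ => norm_nonneg _) (fun t => ?_) h2
    conv_lhs => rw [← posPart_sub_negPart u, map_sub]
    exact norm_sub_le _ _

theorem IsSubstochastic.mul_integral_laplace {lam : ℝ} (hl : 0 < lam) (u : Lp ℝ 1 m) :
    lam * ∫ x, P.laplace hP.isContraction hl u x ∂m = abelMean (P.mass u) lam := by
  rw [← mul_integral_exp_neg_mul_eq_abelMean _ hl, ← L1.integralCLM_apply, P.laplace_apply,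
    ← ContinuousLinearMap.integral_comp_comm _ (hP.isContraction.integrableOn_laplaceIntegrand hl u)]
  simp only [laplaceIntegrand, map_smul, L1.integralCLM_apply, smul_eq_mul, mass]

end C0Semigroup

/-! ### Duality of `L¹` and `L^∞` over a σ-finite measure -/

section LinftyDual

variable {E : Type*} [MeasurableSpace E] {m : Measure E}

theorem MeasureTheory.MemLp.integrable_mul_coeFn {f : E → ℝ} (hf : MemLp f ∞ m)
    (u : Lp ℝ 1 m) : Integrable (fun x => f x * u x) m :=
  hf.integrable_mul (Lp.memLp u)

theorem linfty_nonneg_of_forall_integral_nonneg [SigmaFinite m] {h : Lp ℝ ∞ m}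
    (hh : ∀ u : Lp ℝ 1 m, 0 ≤ u → 0 ≤ ∫ x, h x * u x ∂m) : 0 ≤ h := by
  rw [← Lp.coeFn_nonneg]
  have key : ∀ (s : Set E) (hs : MeasurableSet s) (hms : m s ≠ ∞),
      (fun x => h x * indicatorConstLp 1 hs hms (1 : ℝ) x) =ᵐ[m] s.indicator h := by
    intro s hs hms
    filter_upwards [indicatorConstLp_coeFn (p := 1) (hs := hs) (hμs := hms) (c := (1 : ℝ))] with x hx
    rw [hx]
    by_cases hxs : x ∈ s <;> simp [hxs]
  refine ae_nonneg_of_forall_setIntegral_nonneg_of_sigmaFinite (fun s hs hms => ?_)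
    fun s hs hms => ?_
  · rw [← integrable_indicator_iff hs]
    exact ((Lp.memLp h).integrable_mul_coeFn _).congr (key s hs hms.ne)
  · rw [← integral_indicator hs, ← integral_congr_ae (key s hs hms.ne)]
    refine hh _ ?_
    rw [← Lp.coeFn_nonneg]
    filter_upwards [indicatorConstLp_coeFn (p := 1) (hs := hs) (hμs := hms.ne) (c := (1 : ℝ))]
      with x hx
    rw [hx]
    exact indicator_nonneg (fun _ _ => zero_le_one) x

theorem exists_pos_integrable (m : Measure E) [SigmaFinite m] :
    ∃ p : E → ℝ, (∀ x, 0 < p x) ∧ Measurable p ∧ Integrable p m := by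
  obtain ⟨g, hgpos, hgm, hgint⟩ := exists_pos_lintegral_lt_of_sigmaFinite m one_ne_zero
  refine ⟨fun x => g x, fun x => NNReal.coe_pos.2 (hgpos x), hgm.coe_nnreal_real,
    hgm.coe_nnreal_real.aestronglyMeasurable, ?_⟩
  rw [hasFiniteIntegral_iff_enorm]
  simp only [NNReal.enorm_eq]
  exact hgint.trans ENNReal.one_lt_top

/-- Every bounded functional on `L¹` of a σ-finite measure is represented by an element of
`L^∞`. -/
theorem exists_linfty_of_dual [SigmaFinite m] (Φ : Lp ℝ 1 m →L[ℝ] ℝ) :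
    ∃ h : Lp ℝ ∞ m, ∀ u : Lp ℝ 1 m, ∫ x, h x * u x ∂m = Φ u := by
  obtain ⟨g, hgpos, hgm, hgint⟩ := exists_pos_integrable m
  -- Reduction to Hilbert space: `p > 0` lies in `L²`, so multiplication by `p` maps `L²` to `L¹`.
  -- The Riesz representative `k` of the pulled-back functional makes `k / p` the candidate density.
  set p : E → ℝ := fun x => √(g x) with hpdef
  have hp : ∀ x, 0 < p x := fun x => Real.sqrt_pos.2 (hgpos x)
  have hpm : Measurable p := hgm.sqrt
  have hp2 : MemLp p 2 m := by
    rw [memLp_two_iff_integrable_sq hpm.aestronglyMeasurable]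
    exact hgint.congr (Eventually.of_forall fun x => (Real.sq_sqrt (hgpos x).le).symm)
  let M : Lp ℝ 2 m →L[ℝ] Lp ℝ 1 m :=
    (ContinuousLinearMap.mul ℝ ℝ).holderL m 2 2 1 (hp2.toLp p)
  let k : Lp ℝ 2 m := (InnerProductSpace.toDual ℝ (Lp ℝ 2 m)).symm (Φ.comp M)
  have hk : ∀ (v : E → ℝ), MemLp v 2 m → ∀ u : Lp ℝ 1 m, (u =ᵐ[m] fun x => p x * v x) →
      ∫ x, k x * v x ∂m = Φ u := by
    intro v hv u hu
    have h1 : u = M (hv.toLp v) := by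
      refine Lp.ext (hu.trans ?_)
      have h2 := (ContinuousLinearMap.mul ℝ ℝ).coeFn_holder (r := 1) (hp2.toLp p) (hv.toLp v)
      filter_upwards [h2, hp2.coeFn_toLp, hv.coeFn_toLp] with x hx1 hx2 hx3
      change p x * v x = (ContinuousLinearMap.holder 1 _ _ _ : Lp ℝ 1 m) x
      rw [hx1, hx2, hx3]
      rfl
    have h3 : inner ℝ k (hv.toLp v) = (Φ.comp M) (hv.toLp v) :=
      InnerProductSpace.toDual_symm_apply
    rw [h1, ← ContinuousLinearMap.comp_apply, ← h3, L2.inner_def]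
    refine integral_congr_ae ?_
    filter_upwards [hv.coeFn_toLp] with x hx
    rw [hx, Real.inner_apply]
  have hp2int : Integrable (fun x => ‖Φ‖ * p x ^ 2) m := hp2.integrable_sq.const_mul _
  have hkp : Integrable (fun x => k x * p x) m := (Lp.memLp k).integrable_mul hp2
  -- Testing `Φ` on `p² 1_s` gives `|k p| ≤ ‖Φ‖ p²` a.e., that is, `|k / p| ≤ ‖Φ‖`.
  have hset : ∀ s, MeasurableSet s →
      |∫ x in s, k x * p x ∂m| ≤ ∫ x in s, ‖Φ‖ * p x ^ 2 ∂m := by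
    intro s hs
    have hint : Integrable (s.indicator fun x => p x ^ 2) m := hp2.integrable_sq.indicator hs
    have hu : (hint.toL1 _ : Lp ℝ 1 m) =ᵐ[m] fun x => p x * s.indicator p x := by
      filter_upwards [hint.coeFn_toL1] with x hx
      rw [hx]
      by_cases hxs : x ∈ s <;> simp [hxs, sq]
    have h1 := hk _ (hp2.indicator hs) _ hu
    have h2 : ∫ x, k x * s.indicator p x ∂m = ∫ x in s, k x * p x ∂m := by
      rw [← integral_indicator hs]
      congr 1
      ext x
      by_cases hxs : x ∈ s <;> simp [hxs]
    rw [← h2, h1, integral_const_mul, ← integral_indicator hs]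
    refine (Φ.le_opNorm _).trans (le_of_eq ?_)
    rw [L1.norm_eq_integral_norm]
    congr 1
    refine integral_congr_ae ?_
    filter_upwards [hint.coeFn_toL1] with x hx
    rw [hx, Real.norm_of_nonneg (indicator_nonneg (fun _ _ => sq_nonneg _) x)]
  have hle1 : (fun x => k x * p x) ≤ᵐ[m] fun x => ‖Φ‖ * p x ^ 2 :=
    ae_le_of_forall_setIntegral_le hkp hp2int fun s hs _ => (le_abs_self _).trans (hset s hs)
  have hle2 : (fun x => -(k x * p x)) ≤ᵐ[m] fun x => ‖Φ‖ * p x ^ 2 :=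
    ae_le_of_forall_setIntegral_le hkp.neg hp2int fun s hs _ => by
      rw [integral_neg]
      exact (neg_le_abs _).trans (hset s hs)
  have hbound : ∀ᵐ x ∂m, ‖k x / p x‖ ≤ ‖Φ‖ := by
    filter_upwards [hle1, hle2] with x h1 h2
    have hpx := hp x
    rw [norm_div, Real.norm_of_nonneg hpx.le, div_le_iff₀ hpx, Real.norm_eq_abs]
    have h3 : |k x| * p x ≤ (‖Φ‖ * p x) * p x := by
      rw [← abs_of_pos hpx, ← abs_mul, abs_of_pos hpx, mul_assoc, ← sq]
      exact abs_le'.2 ⟨h1, h2⟩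
    exact le_of_mul_le_mul_right h3 hpx
  have hmeas : AEStronglyMeasurable (fun x => k x / p x) m :=
    ((Lp.aestronglyMeasurable k).aemeasurable.div hpm.aemeasurable).aestronglyMeasurable
  have hmem : MemLp (fun x => k x / p x) ∞ m := memLp_top_of_bound hmeas _ hbound
  refine ⟨hmem.toLp _, fun u => ?_⟩
  have hu1 := L1.integrable_coeFn u
  -- On `s n` the quotient `u / p` is bounded by `n p`, hence in `L²`, where the representation
  -- holds. The sets exhaust `E` because `p > 0`.
  let s : ℕ → Set E := fun n => {x | |u x| ≤ n * p x ^ 2}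
  have hs : ∀ n, MeasurableSet (s n) := fun n =>
    measurableSet_le (Lp.stronglyMeasurable u).measurable.abs ((hpm.pow_const 2).const_mul _)
  have hsint : ∀ n, Integrable ((s n).indicator u) m := fun n => hu1.indicator (hs n)
  have hsev : ∀ x, ∀ᶠ n : ℕ in atTop, x ∈ s n := by
    intro x
    obtain ⟨N, hN⟩ := exists_nat_ge (|u x| / p x ^ 2)
    filter_upwards [eventually_ge_atTop N] with n hn
    have : (N : ℝ) ≤ n := Nat.cast_le.2 hn
    exact (div_le_iff₀ (pow_pos (hp x) 2)).1 (hN.trans this)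
  have hstep : ∀ n, ∫ x, k x / p x * (s n).indicator u x ∂m = Φ ((hsint n).toL1 _) := by
    intro n
    have hv : MemLp (fun x => (s n).indicator u x / p x) 2 m := by
      refine (hp2.const_mul (n : ℝ)).of_le ?_ (Eventually.of_forall fun x => ?_)
      · exact ((hsint n).aestronglyMeasurable.aemeasurable.div
          hpm.aemeasurable).aestronglyMeasurable
      · have hpx := hp x
        rw [norm_div, norm_mul, Real.norm_of_nonneg hpx.le, div_le_iff₀ hpx, Real.norm_natCast,
          mul_assoc, ← sq]
        by_cases hxs : x ∈ s n
        · rw [indicator_of_mem hxs]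
          exact hxs
        · simp only [hxs, not_false_eq_true, indicator_of_notMem, norm_zero]
          positivity
    rw [← hk _ hv _ ?_]
    · congr 1
      ext x
      ring
    · filter_upwards [(hsint n).coeFn_toL1] with x hx
      rw [hx, mul_div_cancel₀ _ (hp x).ne']
  have hlim1 : Tendsto (fun n => ∫ x, k x / p x * (s n).indicator u x ∂m) atTop
      (𝓝 (∫ x, k x / p x * u x ∂m)) := by
    refine tendsto_integral_of_dominated_convergence (fun x => ‖Φ‖ * ‖u x‖)
      (fun n => hmeas.mul (hsint n).aestronglyMeasurable) (hu1.norm.const_mul _) (fun n => ?_)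
      (Eventually.of_forall fun x => ?_)
    · filter_upwards [hbound] with x hx
      rw [norm_mul]
      exact mul_le_mul hx (norm_indicator_le_norm_self _ _) (norm_nonneg _) (norm_nonneg _)
    · refine tendsto_const_nhds.congr' ?_
      filter_upwards [hsev x] with n hn
      rw [indicator_of_mem hn]
  have hlim2 : Tendsto (fun n => (hsint n).toL1 _) atTop (𝓝 u) := by
    rw [tendsto_iff_norm_sub_tendsto_zero]
    have h0 : Tendsto (fun n => ∫ x, ‖(s n).indicator u x - u x‖ ∂m) atTop
        (𝓝 (∫ _ : E, (0 : ℝ) ∂m)) := by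
      refine tendsto_integral_of_dominated_convergence (fun x => ‖u x‖)
        (fun n => ((hsint n).sub hu1).norm.aestronglyMeasurable) hu1.norm
        (fun n => Eventually.of_forall fun x => ?_) (Eventually.of_forall fun x => ?_)
      · rw [norm_norm]
        by_cases hxs : x ∈ s n <;> simp [hxs]
      · refine tendsto_const_nhds.congr' ?_
        filter_upwards [hsev x] with n hn
        rw [indicator_of_mem hn, sub_self, norm_zero]
    rw [integral_zero] at h0
    refine h0.congr fun n => ?_
    rw [L1.norm_eq_integral_norm]
    refine integral_congr_ae ?_
    filter_upwards [(hsint n).coeFn_toL1, Lp.coeFn_sub ((hsint n).toL1 _) u] with x h1 h2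
    rw [h2, Pi.sub_apply, h1]
  have hfin : ∫ x, k x / p x * u x ∂m = Φ u := by
    refine tendsto_nhds_unique hlim1 ?_
    simp only [hstep]
    exact (Φ.continuous.tendsto u).comp hlim2
  rw [← hfin]
  refine integral_congr_ae ?_
  filter_upwards [hmem.coeFn_toLp] with x hx
  rw [hx]

/-- Bounded operators on `L¹` of a σ-finite measure have an adjoint on `L^∞`. -/
theorem isLinftyAdjoint_linftyAdjoint [SigmaFinite m] {T : Lp ℝ 1 m →ₗ[ℝ] Lp ℝ 1 m}
    {T₀ : Lp ℝ 1 m →L[ℝ] Lp ℝ 1 m} (hT : ∀ u, T u = T₀ u) :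
    IsLinftyAdjoint T (linftyAdjoint T) := by
  suffices hex : ∃ T' : Lp ℝ ∞ m →ₗ[ℝ] Lp ℝ ∞ m, IsLinftyAdjoint T T' by
    rw [linftyAdjoint, dif_pos hex]
    exact hex.choose_spec
  let D : Lp ℝ ∞ m →ₗ[ℝ] (Lp ℝ 1 m →L[ℝ] ℝ) :=
    ((ContinuousLinearMap.mul ℝ ℝ).lpPairing m ∞ 1 : Lp ℝ ∞ m →L[ℝ] Lp ℝ 1 m →L[ℝ] ℝ)
  have hD : ∀ (g : Lp ℝ ∞ m) (u : Lp ℝ 1 m), D g u = ∫ x, g x * u x ∂m := fun g u =>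
    ContinuousLinearMap.lpPairing_eq_integral _ g u
  have hinj : Function.Injective D := by
    refine (injective_iff_map_eq_zero D).2 fun g hg => ?_
    have h0 : ∀ u : Lp ℝ 1 m, ∫ x, g x * u x ∂m = 0 := fun u => by rw [← hD, hg]; rfl
    refine le_antisymm (neg_nonneg.1 (linfty_nonneg_of_forall_integral_nonneg fun u _ => ?_))
      (linfty_nonneg_of_forall_integral_nonneg fun u _ => (h0 u).ge)
    rw [← hD, map_neg, neg_apply, hD, h0, neg_zero]
  have hsurj : Function.Surjective D := fun Φ => by
    obtain ⟨g, hg⟩ := exists_linfty_of_dual Φ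
    exact ⟨g, ContinuousLinearMap.ext fun u => by rw [hD, hg]⟩
  -- The adjoint is precomposition with `T₀` on the dual of `L¹`, transported to `L^∞` by this
  -- identification.
  let e := LinearEquiv.ofBijective D ⟨hinj, hsurj⟩
  let C : (Lp ℝ 1 m →L[ℝ] ℝ) →ₗ[ℝ] (Lp ℝ 1 m →L[ℝ] ℝ) :=
    { toFun := fun Φ => Φ.comp T₀
      map_add' := fun _ _ => rfl
      map_smul' := fun _ _ => rfl }
  refine ⟨e.symm.toLinearMap ∘ₗ C ∘ₗ D, fun g u => ?_⟩
  have h1 : D (e.symm (C (D g))) = C (D g) := e.apply_symm_apply _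
  rw [← hD, ← hD, hT]
  exact DFunLike.congr_fun h1 u

end LinftyDual

/-! ### The functions `f_λ`, coherent representatives and the stability criterion -/

section LimitFunction

variable {E : Type*} [MeasurableSpace E] {m : Measure E}

theorem ae_le_of_forall_integral_mul_le [SigmaFinite m] {f g : E → ℝ} (hf : MemLp f ∞ m)
    (hg : MemLp g ∞ m)
    (h : ∀ u : Lp ℝ 1 m, 0 ≤ u → ∫ x, f x * u x ∂m ≤ ∫ x, g x * u x ∂m) : f ≤ᵐ[m] g := by
  have h0 : 0 ≤ (hg.sub hf).toLp (g - f) := by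
    refine linfty_nonneg_of_forall_integral_nonneg fun u hu => ?_
    have h1 : ∫ x, (hg.sub hf).toLp (g - f) x * u x ∂m = ∫ x, g x * u x - f x * u x ∂m := by
      refine integral_congr_ae ?_
      filter_upwards [(hg.sub hf).coeFn_toLp] with x hx
      rw [hx, Pi.sub_apply, sub_mul]
    rw [h1, integral_sub (hg.integrable_mul_coeFn u) (hf.integrable_mul_coeFn u)]
    exact sub_nonneg.2 (h u hu)
  filter_upwards [(Lp.coeFn_nonneg _).2 h0, (hg.sub hf).coeFn_toLp] with x hx1 hx2
  rw [hx2] at hx1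
  exact sub_nonneg.1 hx1

/-- The functions `(B R(lam, A))^{*n} 1`. -/
noncomputable def adjointIterate (A B : Lp ℝ 1 m →ₗ.[ℝ] Lp ℝ 1 m) (lam : ℝ) (n : ℕ) : Lp ℝ ∞ m :=
  (linftyAdjoint (opBR A B lam) ^ n) (linftyOne m)

/-- The canonical representative of the limit of `(B R(lam, A))^{*n} 1`. -/
noncomputable def adjointLimit (A B : Lp ℝ 1 m →ₗ.[ℝ] Lp ℝ 1 m) (lam : ℝ) (x : E) : ℝ :=
  ⨅ n, adjointIterate A B lam n x

theorem measurable_adjointLimit (A B : Lp ℝ 1 m →ₗ.[ℝ] Lp ℝ 1 m) (lam : ℝ) :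
    Measurable (adjointLimit A B lam) :=
  Measurable.iInf fun n => (Lp.stronglyMeasurable (adjointIterate A B lam n)).measurable

theorem adjointIterate_zero (A B : Lp ℝ 1 m →ₗ.[ℝ] Lp ℝ 1 m) (lam : ℝ) :
    adjointIterate A B lam 0 =ᵐ[m] fun _ => 1 :=
  (memLp_top_const (1 : ℝ)).coeFn_toLp

theorem aestronglyMeasurable_limitFunction {A B : Lp ℝ 1 m →ₗ.[ℝ] Lp ℝ 1 m}
    {f : ℝ → E → ℝ} (hf : IsLimitFunction A B f)
    {lam : ℝ} (hl : 0 < lam) : AEStronglyMeasurable (f lam) m :=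
  aestronglyMeasurable_of_tendsto_ae atTop
    (fun n => Lp.aestronglyMeasurable (adjointIterate A B lam n)) (hf lam hl)

namespace IsKatoPair

variable {A B : Lp ℝ 1 m →ₗ.[ℝ] Lp ℝ 1 m} {R K : ℝ → Lp ℝ 1 m →L[ℝ] Lp ℝ 1 m}
  [SigmaFinite m] (h : IsKatoPair A B R K)
include h

theorem integral_adjointIterate {lam : ℝ} (hl : 0 < lam) (n : ℕ) (u : Lp ℝ 1 m) :
    ∫ x, adjointIterate A B lam n x * u x ∂m = ∫ x, (K lam ^ n) u x ∂m := by
  induction n generalizing u with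
  | zero =>
    refine integral_congr_ae ?_
    filter_upwards [adjointIterate_zero A B lam] with x hx
    rw [hx, one_mul]
    rfl
  | succ n ih =>
    have h1 := isLinftyAdjoint_linftyAdjoint (h.opBR_eq lam hl) (adjointIterate A B lam n) u
    rw [h.opBR_eq lam hl, ih] at h1
    rw [pow_succ (K lam), mul_apply_eq_comp, ← h1, adjointIterate, pow_succ']
    rfl

theorem adjointIterate_nonneg {lam : ℝ} (hl : 0 < lam) (n : ℕ) :
    0 ≤ adjointIterate A B lam n :=
  linfty_nonneg_of_forall_integral_nonneg fun u hu => by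
    rw [h.integral_adjointIterate hl]
    exact L1.integral_coeFn_nonneg
      (ContinuousLinearMap.pow_apply_nonneg (h.right_nonneg lam hl) n hu)

theorem adjointIterate_succ_le {lam : ℝ} (hl : 0 < lam) (n : ℕ) :
    adjointIterate A B lam (n + 1) ≤ adjointIterate A B lam n := by
  rw [← Lp.coeFn_le]
  refine ae_le_of_forall_integral_mul_le (Lp.memLp _) (Lp.memLp _) fun u hu => ?_
  rw [h.integral_adjointIterate hl, h.integral_adjointIterate hl, pow_succ', mul_apply_eq_comp]
  have hpow := ContinuousLinearMap.pow_apply_nonneg (h.right_nonneg lam hl) n hu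
  have h1 := h.integral_left lam hl ((K lam ^ n) u)
  have h2 := mul_nonneg hl.le (L1.integral_coeFn_nonneg (h.left_nonneg lam hl _ hpow))
  linarith

theorem ae_antitone_adjointIterate {lam : ℝ} (hl : 0 < lam) :
    ∀ᵐ x ∂m, Antitone (fun n => adjointIterate A B lam n x) ∧
      ∀ n, adjointIterate A B lam n x ∈ Icc (0 : ℝ) 1 := by
  have h1 : ∀ᵐ x ∂m, ∀ n, adjointIterate A B lam (n + 1) x ≤ adjointIterate A B lam n x :=
    ae_all_iff.2 fun n => (Lp.coeFn_le _ _).2 (h.adjointIterate_succ_le hl n)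
  have h2 : ∀ᵐ x ∂m, ∀ n, 0 ≤ adjointIterate A B lam n x :=
    ae_all_iff.2 fun n => (Lp.coeFn_nonneg _).2 (h.adjointIterate_nonneg hl n)
  filter_upwards [h1, h2, adjointIterate_zero A B lam] with x hx1 hx2 hx3
  have hanti : Antitone fun n => adjointIterate A B lam n x := antitone_nat_of_succ_le hx1
  exact ⟨hanti, fun n => ⟨hx2 n, (hanti (Nat.zero_le n)).trans hx3.le⟩⟩

theorem isLimitFunction_adjointLimit : IsLimitFunction A B (adjointLimit A B) := by
  intro lam hl
  filter_upwards [h.ae_antitone_adjointIterate hl] with x hx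
  refine tendsto_atTop_ciInf hx.1 ⟨0, ?_⟩
  rintro _ ⟨n, rfl⟩
  exact (hx.2 n).1

theorem ae_mem_Icc {f : ℝ → E → ℝ} (hf : IsLimitFunction A B f) {lam : ℝ} (hl : 0 < lam) :
    ∀ᵐ x ∂m, f lam x ∈ Icc (0 : ℝ) 1 := by
  filter_upwards [h.ae_antitone_adjointIterate hl, hf lam hl] with x hx hfx
  exact isClosed_Icc.mem_of_tendsto hfx (Eventually.of_forall hx.2)

theorem memLp_limitFunction {f : ℝ → E → ℝ} (hf : IsLimitFunction A B f) {lam : ℝ}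
    (hl : 0 < lam) : MemLp (f lam) ∞ m := by
  refine memLp_top_of_bound (aestronglyMeasurable_limitFunction hf hl) 1 ?_
  filter_upwards [h.ae_mem_Icc hf hl] with x hx
  rw [Real.norm_of_nonneg hx.1]
  exact hx.2

/-- The bridge between `f_λ` and the semigroup: the integral of the `n`-th iterate against `u` is `∫
u` minus `lam` times the integral of a partial sum of the resolvent series. Dominated convergence
handles one side, the resolvent formula the other. -/
theorem integral_limitFunction_mul {P : C0Semigroup (Lp ℝ 1 m)} (hP : IsMinimalKatoVoigt A B P)
    {f : ℝ → E → ℝ} (hf : IsLimitFunction A B f) {lam : ℝ} (hl : 0 < lam) (u : Lp ℝ 1 m) :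
    ∫ x, f lam x * u x ∂m = ∫ x, u x ∂m - abelMean (P.mass u) lam := by
  have hlim1 : Tendsto (fun n => ∫ x, adjointIterate A B lam n x * u x ∂m) atTop
      (𝓝 (∫ x, f lam x * u x ∂m)) := by
    refine tendsto_integral_of_dominated_convergence (fun x => ‖u x‖)
      (fun n => (Lp.aestronglyMeasurable _).mul (Lp.aestronglyMeasurable u))
      (L1.integrable_coeFn u).norm (fun n => ?_) ?_
    · filter_upwards [h.ae_antitone_adjointIterate hl] with x hx
      rw [norm_mul, Real.norm_of_nonneg (hx.2 n).1]
      exact mul_le_of_le_one_left (norm_nonneg _) (hx.2 n).2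
    · filter_upwards [hf lam hl] with x hx
      exact hx.mul_const _
  have hsum := ((h.hasSum_laplace hP hl u).mapL
    (L1.integralCLM (E := ℝ) : Lp ℝ 1 m →L[ℝ] ℝ)).tendsto_sum_nat
  simp only [L1.integralCLM_apply] at hsum
  have hlim2 := (hsum.const_mul lam).const_sub (∫ x, u x ∂m)
  rw [hP.1.1.mul_integral_laplace hl] at hlim2
  refine tendsto_nhds_unique hlim1 (hlim2.congr fun n => ?_)
  rw [h.integral_sum_range hl, h.integral_adjointIterate hl, sub_sub_cancel]

theorem limitFunction_ae_antitone {P : C0Semigroup (Lp ℝ 1 m)} (hP : IsMinimalKatoVoigt A B P)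
    {f : ℝ → E → ℝ} (hf : IsLimitFunction A B f) {lam mu : ℝ} (hl : 0 < lam) (hlm : lam ≤ mu) :
    f mu ≤ᵐ[m] f lam := by
  have hm := hl.trans_le hlm
  refine ae_le_of_forall_integral_mul_le (h.memLp_limitFunction hf hm)
    (h.memLp_limitFunction hf hl) fun u hu => ?_
  rw [h.integral_limitFunction_mul hP hf hl, h.integral_limitFunction_mul hP hf hm]
  exact sub_le_sub_left (abelMean_mono (P.continuous_mass u) (hP.1.1.norm_mass_le hu)
    (hP.1.1.antitone_mass hu) hl hlm) _

theorem exists_isCoherentLimitFunction {P : C0Semigroup (Lp ℝ 1 m)}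
    (hP : IsMinimalKatoVoigt A B P) : ∃ f : ℝ → E → ℝ, IsCoherentLimitFunction A B f := by
  set g := adjointLimit A B
  have hg : IsLimitFunction A B g := h.isLimitFunction_adjointLimit
  -- The supremum over rationals above `lam` decreases in `lam` by construction, and countability
  -- leaves a single null set to discard.
  let f : ℝ → E → ℝ := fun lam x => ⨆ q : {q : ℚ // lam < q}, g q x
  have hne : ∀ lam : ℝ, Nonempty {q : ℚ // lam < q} := fun lam =>
    let ⟨q, hq⟩ := exists_rat_gt lam
    ⟨⟨q, hq⟩⟩
  have hbd : ∀ᵐ x ∂m, ∀ q : ℚ, (0 : ℝ) < q → g q x ∈ Icc (0 : ℝ) 1 :=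
    ae_all_iff.2 fun q => by
      by_cases hq : (0 : ℝ) < q
      · filter_upwards [h.ae_mem_Icc hg hq] with x hx _
        exact hx
      · exact Eventually.of_forall fun x h0 => absurd h0 hq
  have hbdd : ∀ᵐ x ∂m, ∀ lam : ℝ, 0 < lam →
      BddAbove (range fun q : {q : ℚ // lam < q} => g q x) := by
    filter_upwards [hbd] with x hx lam hl
    refine ⟨1, ?_⟩
    rintro _ ⟨q, rfl⟩
    exact (hx q (hl.trans q.2)).2
  have hfmem : ∀ lam : ℝ, 0 < lam → MemLp (f lam) ∞ m := by
    intro lam hl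
    have hmeas : Measurable (f lam) := Measurable.iSup fun q => measurable_adjointLimit A B _
    refine memLp_top_of_bound hmeas.aestronglyMeasurable 1 ?_
    filter_upwards [hbd, hbdd] with x hx hx'
    obtain ⟨q⟩ := hne lam
    have h0 : 0 ≤ f lam x := (hx q (hl.trans q.2)).1.trans (le_ciSup (hx' lam hl) q)
    have := hne lam
    rw [Real.norm_of_nonneg h0]
    exact ciSup_le fun q => (hx q (hl.trans q.2)).2
  have heq : ∀ lam : ℝ, 0 < lam → f lam =ᵐ[m] g lam := by
    intro lam hl
    have hle : f lam ≤ᵐ[m] g lam := by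
      have : ∀ᵐ x ∂m, ∀ q : {q : ℚ // lam < q}, g q x ≤ g lam x :=
        ae_all_iff.2 fun q => h.limitFunction_ae_antitone hP hg hl q.2.le
      filter_upwards [this] with x hx
      have := hne lam
      exact ciSup_le hx
    -- The reverse inequality is tested on `u ≥ 0`: rationals `q n ↓ lam` satisfy `∫ g (q n) u ≤ ∫ f
    -- lam u`, and the left side tends to `∫ g lam u` by continuity of the Abel mean.
    refine hle.antisymm (ae_le_of_forall_integral_mul_le (h.memLp_limitFunction hg hl)
      (hfmem lam hl) fun u hu => ?_)
    obtain ⟨q, -, hq, hlim⟩ := Real.exists_seq_rat_strictAnti_tendsto lam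
    have hlim' := ((tendsto_abelMean_nhds (P.continuous_mass u) (hP.1.1.norm_mass_le hu) hl).comp
      hlim).const_sub (∫ x, u x ∂m)
    rw [← h.integral_limitFunction_mul hP hg hl] at hlim'
    refine le_of_tendsto hlim' (Eventually.of_forall fun n => ?_)
    have hqn : (0 : ℝ) < q n := hl.trans (hq n)
    rw [Function.comp_apply, ← h.integral_limitFunction_mul hP hg hqn]
    refine integral_mono_ae ((h.memLp_limitFunction hg hqn).integrable_mul_coeFn u)
      ((hfmem lam hl).integrable_mul_coeFn u) ?_
    filter_upwards [hbdd, (Lp.coeFn_nonneg u).2 hu] with x hx hux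
    exact mul_le_mul_of_nonneg_right (le_ciSup (hx lam hl) ⟨q n, hq n⟩) hux
  refine ⟨f, fun lam hl => ?_, ?_⟩
  · filter_upwards [hg lam hl, heq lam hl] with x hx hxe
    rwa [hxe]
  · filter_upwards [hbdd] with x hx lam hl mu _ hlm
    have := hne mu
    exact ciSup_le fun q => le_ciSup (hx lam hl) ⟨q, lt_of_le_of_lt hlm q.2⟩

theorem integral_liminf_mul {P : C0Semigroup (Lp ℝ 1 m)} (hP : IsMinimalKatoVoigt A B P)
    {f : ℝ → E → ℝ} (hf : IsCoherentLimitFunction A B f) :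
    (∀ᵐ x ∂m, liminf (fun lam => f lam x) (𝓝[>] 0) ∈ Icc (0 : ℝ) 1) ∧
      MemLp (fun x => liminf (fun lam => f lam x) (𝓝[>] 0)) ∞ m ∧
      ∀ (u : Lp ℝ 1 m) (l : ℝ), 0 ≤ u → Tendsto (P.mass u) atTop (𝓝 l) →
        ∫ x, liminf (fun lam => f lam x) (𝓝[>] 0) * u x ∂m = ∫ x, u x ∂m - l := by
  let a : ℕ → ℝ := fun n => 1 / ((n : ℝ) + 1)
  have ha : ∀ n, 0 < a n := fun n => Nat.one_div_pos_of_nat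
  have halim : Tendsto a atTop (𝓝[>] 0) := tendsto_nhdsWithin_iff.2
    ⟨tendsto_one_div_add_atTop_nhds_zero_nat, Eventually.of_forall ha⟩
  have hIcc : ∀ᵐ x ∂m, ∀ n, f (a n) x ∈ Icc (0 : ℝ) 1 :=
    ae_all_iff.2 fun n => h.ae_mem_Icc hf.1 (ha n)
  have hlim : ∀ᵐ x ∂m, Tendsto (fun n => f (a n) x) atTop
      (𝓝 (liminf (fun lam => f lam x) (𝓝[>] 0))) := by
    filter_upwards [hIcc, hf.2] with x hx hanti
    -- The bound `f ≤ 1` is known a.e. only along the countable sequence `a n`; monotonicity carries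
    -- it to all `lam > 0`. The lower limit is then a true limit, attained along `a n`.
    have hbdd : BddAbove ((fun lam => f lam x) '' Ioi 0) := by
      refine ⟨1, ?_⟩
      rintro _ ⟨lam, hl, rfl⟩
      obtain ⟨n, hn⟩ := exists_nat_one_div_lt (mem_Ioi.1 hl)
      exact (hanti (ha n) hl hn.le).trans (hx n).2
    have := hanti.tendsto_nhdsGT hbdd
    rw [this.liminf_eq]
    exact this.comp halim
  have hmem : ∀ᵐ x ∂m, liminf (fun lam => f lam x) (𝓝[>] 0) ∈ Icc (0 : ℝ) 1 := by
    filter_upwards [hIcc, hlim] with x hx hxl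
    exact isClosed_Icc.mem_of_tendsto hxl (Eventually.of_forall hx)
  refine ⟨hmem, memLp_top_of_bound (aestronglyMeasurable_of_tendsto_ae atTop
    (fun n => aestronglyMeasurable_limitFunction hf.1 (ha n)) hlim) 1 ?_, fun u l hu hl => ?_⟩
  · filter_upwards [hmem] with x hx
    rw [Real.norm_of_nonneg hx.1]
    exact hx.2
  · have h1 : Tendsto (fun n => ∫ x, f (a n) x * u x ∂m) atTop
        (𝓝 (∫ x, liminf (fun lam => f lam x) (𝓝[>] 0) * u x ∂m)) := by
      refine tendsto_integral_of_dominated_convergence (fun x => ‖u x‖)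
        (fun n => (aestronglyMeasurable_limitFunction hf.1 (ha n)).mul
          (Lp.aestronglyMeasurable u))
        (L1.integrable_coeFn u).norm (fun n => ?_) ?_
      · filter_upwards [hIcc] with x hx
        rw [norm_mul, Real.norm_of_nonneg (hx n).1]
        exact mul_le_of_le_one_left (norm_nonneg _) (hx n).2
      · filter_upwards [hlim] with x hx
        exact hx.mul_const _
    have h2 := ((tendsto_abelMean_nhdsGT_zero (P.continuous_mass u) (hP.1.1.norm_mass_le hu)
      hl).comp halim).const_sub (∫ x, u x ∂m)
    exact tendsto_nhds_unique h1 (h2.congr fun n =>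
      (h.integral_limitFunction_mul hP hf.1 (ha n) u).symm)

theorem stronglyStable_iff {P : C0Semigroup (Lp ℝ 1 m)} (hP : IsMinimalKatoVoigt A B P)
    {f : ℝ → E → ℝ} (hf : IsCoherentLimitFunction A B f) :
    P.StronglyStable ↔ m {x | liminf (fun lam : ℝ => f lam x) (𝓝[>] 0) < 1} = 0 := by
  obtain ⟨hIcc, hmem, hint⟩ := h.integral_liminf_mul hP hf
  rw [hP.1.1.stronglyStable_iff]
  constructor
  · intro hst
    -- Stability gives `∫ (1 - f₀) p = 0` with a nonnegative integrand and `p > 0` everywhere, which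
    -- forces `f₀ = 1` a.e.
    obtain ⟨p, hp, -, hpint⟩ := exists_pos_integrable m
    have hpos : 0 ≤ hpint.toL1 p := by
      rw [← Lp.coeFn_nonneg]
      filter_upwards [hpint.coeFn_toL1] with x hx
      rw [hx]
      exact (hp x).le
    have h1 := hint _ 0 hpos (hst _ hpos)
    have hi1 := L1.integrable_coeFn (hpint.toL1 p)
    have hi2 := hmem.integrable_mul_coeFn (hpint.toL1 p)
    have h2 : ∫ x, (hpint.toL1 p x -
        liminf (fun lam : ℝ => f lam x) (𝓝[>] 0) * hpint.toL1 p x) ∂m = 0 := by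
      rw [integral_sub hi1 hi2, h1, sub_zero, sub_self]
    have hnn : 0 ≤ᵐ[m] fun x => hpint.toL1 p x -
        liminf (fun lam : ℝ => f lam x) (𝓝[>] 0) * hpint.toL1 p x := by
      filter_upwards [hIcc, (Lp.coeFn_nonneg _).2 hpos] with x hx hux
      exact sub_nonneg.2 (mul_le_of_le_one_left hux hx.2)
    have h3 := (integral_eq_zero_iff_of_nonneg_ae hnn (hi1.sub hi2)).1 h2
    have h4 : ∀ᵐ x ∂m, ¬ liminf (fun lam : ℝ => f lam x) (𝓝[>] 0) < 1 := by
      filter_upwards [h3, hpint.coeFn_toL1] with x hx hxp hlt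
      rw [hxp] at hx
      exact (mul_lt_of_lt_one_left (hp x) hlt).ne (sub_eq_zero.1 hx).symm
    simpa only [ae_iff, not_not] using h4
  · intro hnull u hu
    obtain ⟨l, hl⟩ := hP.1.1.exists_tendsto_mass hu
    have h1 := hint u l hu hl
    have h2 : ∫ x, liminf (fun lam => f lam x) (𝓝[>] 0) * u x ∂m = ∫ x, u x ∂m := by
      have hae : ∀ᵐ x ∂m, ¬ liminf (fun lam : ℝ => f lam x) (𝓝[>] 0) < 1 := by
        simpa only [ae_iff, not_not] using hnull
      refine integral_congr_ae ?_
      filter_upwards [hIcc, hae] with x hx hx1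
      rw [le_antisymm hx.2 (not_lt.1 hx1), one_mul]
    have h0 : l = 0 := by linarith
    rwa [h0] at hl

end IsKatoPair

end LimitFunction

theorem theorem3p3 {E : Type*} [MeasurableSpace E] (m : Measure E) [SigmaFinite m]
    (A B : Lp ℝ 1 m →ₗ.[ℝ] Lp ℝ 1 m)
    (hG1 : ∃ S : C0Semigroup (Lp ℝ 1 m), S.IsSubstochastic ∧ S.generator = A)
    (hAB : A.domain ≤ B.domain)
    (hG2 : ∀ (u : Lp ℝ 1 m) (hu : u ∈ A.domain), 0 ≤ u → 0 ≤ B ⟨u, hAB hu⟩)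
    (hG3 : ∀ (u : Lp ℝ 1 m) (hu : u ∈ A.domain), 0 ≤ u →
      ∫ x, (A ⟨u, hu⟩ + B ⟨u, hAB hu⟩ : Lp ℝ 1 m) x ∂m = 0)
    (P : C0Semigroup (Lp ℝ 1 m)) (hP : IsMinimalKatoVoigt A B P) :
    (∃ f : ℝ → E → ℝ, IsCoherentLimitFunction A B f) ∧
      ∀ f : ℝ → E → ℝ, IsCoherentLimitFunction A B f →
        (P.StronglyStable ↔
          m {x | liminf (fun lam : ℝ => f lam x) (𝓝[>] 0) < 1} = 0) := by
  obtain ⟨S, hS, hSA⟩ := hG1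
  obtain ⟨R, K, h⟩ := exists_isKatoPair hS hSA hAB hG2 hG3
  exact ⟨h.exists_isCoherentLimitFunction hP, fun f hf => h.stronglyStable_iff hP hf⟩
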